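/- Let $\alpha_1,\alpha_2\ge 0$ be constants and, for each $n$, let $m_1=m_1(n)$ and $m_2=m_2(n)$ be nonnegative integers with $m_i/n\to\alpha_i$ as $n\to\infty$ (for instance $m_i=\alpha_i n$ up to rounding). For each $n$ let $A\in\mathbb R^{m_1\times n}$ and $B\in\mathbb R^{m_2\times n}$ be random matrices all of whose entries (of $A$ and $B$ jointly) are i.i.d. standard normal, let $g\in\mathbb R^n$ be a random vector with i.i.d. standard normal components, and let $f=f_n:\mathbb R^n\to\mathbb R$ be a given deterministic function. Put $$\xi(f,A,B)=\inf\{f(x): x\in\mathbb R^n,\ Ax=0,\ Bx\le 0\}\in[-\infty,\infty],$$ and say that events $E_n$ hold with overwhelming probability if there is $c>0$ with $P(E_n)\ge 1-e^{-cn}$ for all large $n$. Assume that $|\xi(f,A,B)|<\infty$ with overwhelming probability. Let $\varepsilon_1,\varepsilon_5>0$ be arbitrary constants independent of $n$, and for a scalar $t$ put $$L^{(1)}(t)=\inf\Big\{f(x)-t:\ x\in\mathbb R^n,\ g^Tx+\|x\|_2\big((1-\varepsilon_1)\sqrt{m_1+m_2/2}-\varepsilon_5\sqrt n\big)\le 0\Big\}.$$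 Let $\xi_D^{(l)}=\xi_D^{(l)}(f_n)$ be any (in particular, the largest, if there is a largest) scalars, depending on $n$, such that $L^{(1)}(\xi_D^{(l)})\ge 0$ with overwhelming probability. Then $$\lim_{n\to\infty}P\big(\xi(f,A,B)\ge\xi_D^{(l)}(f)\big)=1 .$$ If moreover $L^{(1)}(\xi_D^{(l)})>0$ with overwhelming probability, then $$\lim_{n\to\infty}P\big(\xi(f,A,B)>\xi_D^{(l)}(f)\big)=1 .$$ (For functions $f$ for which these events are not measurable, $P$ denotes the inner probability.) -/

import Mathlib

open MeasureTheory ProbabilityTheory Filter Topology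
open scoped Matrix

namespace RandLinCons

/-- The feasible set `{x ∈ ℝⁿ : A x = 0, B x ≤ 0}` (the inequality is componentwise). -/
def feasibleSet {m₁ m₂ n : ℕ} (A : Matrix (Fin m₁) (Fin n) ℝ) (B : Matrix (Fin m₂) (Fin n) ℝ) :
    Set (EuclideanSpace ℝ (Fin n)) :=
  {x | A *ᵥ x.ofLp = 0 ∧ B *ᵥ x.ofLp ≤ 0}

/-- The optimal value `ξ(f, A, B)` of `min f(x)` subject to `A x = 0`, `B x ≤ 0`,
as an extended real number (`⊥` if the program is unbounded below). -/
noncomputable def xi {m₁ m₂ n : ℕ} (f : EuclideanSpace ℝ (Fin n) → ℝ)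
    (A : Matrix (Fin m₁) (Fin n) ℝ) (B : Matrix (Fin m₂) (Fin n) ℝ) : EReal :=
  ⨅ x ∈ feasibleSet A B, (f x : EReal)

/-- The feasible set of the auxiliary program:
`gᵀ x + ‖x‖₂ ((1 - ε₁) √(m₁ + m₂ / 2) - ε₅ √n) ≤ 0`. -/
def auxFeasibleSet {n : ℕ} (m₁ m₂ : ℕ) (ε₁ ε₅ : ℝ) (g : Fin n → ℝ) :
    Set (EuclideanSpace ℝ (Fin n)) :=
  {x | g ⬝ᵥ x.ofLp
      + ‖x‖ * ((1 - ε₁) * √((m₁ : ℝ) + (m₂ : ℝ) / 2) - ε₅ * √(n : ℝ)) ≤ 0}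

/-- The optimal value `L⁽¹⁾` of the auxiliary program: `min (f(x) - t)` over `auxFeasibleSet`,
as an extended real number. -/
noncomputable def auxL {n : ℕ} (f : EuclideanSpace ℝ (Fin n) → ℝ) (t : ℝ)
    (m₁ m₂ : ℕ) (ε₁ ε₅ : ℝ) (g : Fin n → ℝ) : EReal :=
  ⨅ x ∈ auxFeasibleSet m₁ m₂ ε₁ ε₅ g, ((f x - t : ℝ) : EReal)

/-- The random variables `X i` are i.i.d. standard normal. -/
def IsIIDStdNormal {Ω ι : Type*} [MeasurableSpace Ω] (X : ι → Ω → ℝ) (P : Measure Ω) : Prop :=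
  (∀ i, HasLaw (X i) (gaussianReal 0 1) P) ∧ iIndepFun X P

/-- All entries of the two random matrices together, as one family of random variables. -/
def entries {Ω : Type*} {m₁ m₂ n : ℕ} (A : Ω → Matrix (Fin m₁) (Fin n) ℝ)
    (B : Ω → Matrix (Fin m₂) (Fin n) ℝ) :
    (Fin m₁ × Fin n) ⊕ (Fin m₂ × Fin n) → Ω → ℝ :=
  Sum.elim (fun p ω => A ω p.1 p.2) (fun p ω => B ω p.1 p.2)

/-- The (inner) probability of an event: `1` minus the outer measure of the complement.
It is `P s` for every (null-)measurable event, see `prob_eq`, and for the events of an arbitrary,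
possibly non-measurable, objective function a lower bound on it is the stronger claim. -/
noncomputable def prob {Ω : Type*} [MeasurableSpace Ω] (P : Measure Ω) (s : Set Ω) : ℝ :=
  1 - P.real sᶜ

theorem prob_eq {Ω : Type*} [MeasurableSpace Ω] (P : Measure Ω) [IsProbabilityMeasure P]
    {s : Set Ω} (hs : NullMeasurableSet s P) : prob P s = P.real s := by
  unfold prob
  rw [measureReal_def, measureReal_def, prob_compl_eq_one_sub₀ hs,
    ENNReal.toReal_sub_of_le prob_le_one ENNReal.one_ne_top]
  simp

/-- The events `s n` hold with overwhelming probability: the probability is at most a number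
exponentially decaying in `n` away from `1`. -/
def WithOverwhelmingProb {Ω : ℕ → Type*} [∀ n, MeasurableSpace (Ω n)]
    (P : ∀ n, Measure (Ω n)) (s : ∀ n, Set (Ω n)) : Prop :=
  ∃ c : ℝ, 0 < c ∧ ∀ᶠ n : ℕ in atTop, 1 - Real.exp (-c * (n : ℝ)) ≤ prob (P n) (s n)

end RandLinCons

namespace RandLinCons

/-! If `ξ < t`, the random cone `{Ax = 0, Bx ≤ 0}` meets the deterministic set `{f < t}`. The cone
and the auxiliary constraint are both invariant under positive scaling, so only the set `K` of
directions of `{f < t}` matters, and the question is when a random cone hits a subset of the sphere.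

For `x` in the cone, `yᵀGx ≤ 0` for every `y` of norm at most one that is nonnegative on the
inequality rows. Gordon's inequality (`gordon_comparison`) compares `yᵀGx + s`, with `s` an
independent standard normal, to `gᵀx + hᵀy`. The supremum of `hᵀy` over such `y` is the distance
from `h` to `{h₁ = 0, h₂ ≤ 0}`, whose square has mean `m₁ + m₂/2` and variance `O(m₁ + m₂)`. So, for
any `c`, `measure_escape_le` bounds the probability of a hit by that of `gᵀx < -c` for some `x ∈ K`,
plus that of the distance being at most `c + 3δ`, plus the tail of `s` beyond `δ`.

With `c = (1-ε₁)√(m₁+m₂/2) - ε₅√n` the first event forces `L⁽¹⁾ < 0`, which is exponentially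
unlikely. The slack `ε₅√n` pays for `δ` and for the fluctuation of the distance, and Chebyshev makes
both remaining errors `O(1/n)` (`tendsto_escape_error`). -/

/-- The standard Gaussian measure on `ι → ℝ`. -/
noncomputable abbrev stdPi (ι : Type*) [Fintype ι] : Measure (ι → ℝ) :=
  Measure.pi fun _ => gaussianReal 0 1

/-! ### Gaussian integration by parts on the line -/

theorem hasDerivAt_gaussianPDFReal_zero_one (x : ℝ) :
    HasDerivAt (gaussianPDFReal 0 1) (-(x * gaussianPDFReal 0 1 x)) x := by
  have h : HasDerivAt (fun x : ℝ => (√(2 * Real.pi * 1))⁻¹ * Real.exp (-(x - 0) ^ 2 / (2 * 1)))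
      ((√(2 * Real.pi * 1))⁻¹ * (Real.exp (-(x - 0) ^ 2 / (2 * 1)) * (-x))) x := by
    refine HasDerivAt.const_mul _ (HasDerivAt.exp ?_)
    have := ((((hasDerivAt_id x).sub_const 0).pow 2).neg).div_const (2 * 1 : ℝ)
    refine this.congr_deriv ?_
    simp
    ring
  have e : gaussianPDFReal 0 1 =
      fun x : ℝ => (√(2 * Real.pi * 1))⁻¹ * Real.exp (-(x - 0) ^ 2 / (2 * 1)) := by
    rw [gaussianPDFReal_def]; simp
  rw [e]
  refine h.congr_deriv ?_
  ring

theorem integrable_gaussianReal_iff (f : ℝ → ℝ) :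
    Integrable f (gaussianReal 0 1) ↔ Integrable (fun x => gaussianPDFReal 0 1 x * f x) := by
  rw [gaussianReal_of_var_ne_zero 0 one_ne_zero,
    integrable_withDensity_iff_integrable_smul' (measurable_gaussianPDF _ _)
      (ae_of_all _ fun _ ↦ gaussianPDF_lt_top)]
  simp [toReal_gaussianPDF]

theorem integrable_id_gaussianReal : Integrable (fun x : ℝ => x) (gaussianReal 0 1) :=
  (memLp_id_gaussianReal (μ := 0) (v := 1) 1).integrable le_rfl

/-- Gaussian integration by parts on the line. -/
theorem integral_id_mul_gaussianReal {f f' : ℝ → ℝ} (hf : ∀ x, HasDerivAt f (f' x) x)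
    (hf'c : Continuous f') {C : ℝ} (hC : ∀ x, |f x| ≤ C) (hC' : ∀ x, |f' x| ≤ C) :
    ∫ x, x * f x ∂(gaussianReal 0 1) = ∫ x, f' x ∂(gaussianReal 0 1) := by
  have hfc : Continuous f := continuous_iff_continuousAt.2 fun x => (hf x).continuousAt
  have h1 : Integrable (fun x => x * f x) (gaussianReal 0 1) :=
    integrable_id_gaussianReal.mul_bdd (c := C) hfc.aestronglyMeasurable (ae_of_all _ hC)
  have h2 : Integrable f (gaussianReal 0 1) :=
    (integrable_const C).mono' hfc.aestronglyMeasurable (ae_of_all _ hC)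
  have h3 : Integrable f' (gaussianReal 0 1) :=
    (integrable_const C).mono' hf'c.aestronglyMeasurable (ae_of_all _ hC')
  have key := integral_mul_deriv_eq_deriv_mul_of_integrable (u := f) (u' := f')
    (v := gaussianPDFReal 0 1) (v' := fun x => -(x * gaussianPDFReal 0 1 x))
    (fun x _ => hf x) (fun x _ => hasDerivAt_gaussianPDFReal_zero_one x)
    (by
      refine ((integrable_gaussianReal_iff _).1 h1).neg.congr (ae_of_all _ fun x => ?_)
      simp only [Pi.mul_apply, Pi.neg_apply]; ring)
    (by
      refine ((integrable_gaussianReal_iff _).1 h3).congr (ae_of_all _ fun x => ?_)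
      simp only [Pi.mul_apply]; ring)
    (by
      refine ((integrable_gaussianReal_iff _).1 h2).congr (ae_of_all _ fun x => ?_)
      simp only [Pi.mul_apply]; ring)
  rw [integral_gaussianReal_eq_integral_smul one_ne_zero,
    integral_gaussianReal_eq_integral_smul one_ne_zero]
  have e1 : ∫ x, f x * -(x * gaussianPDFReal 0 1 x) =
      -∫ x, gaussianPDFReal 0 1 x • (x * f x) := by
    rw [← integral_neg]; congr 1; ext x; simp only [smul_eq_mul]; ring
  have e2 : ∫ x, f' x * gaussianPDFReal 0 1 x = ∫ x, gaussianPDFReal 0 1 x • f' x := by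
    congr 1; ext x; simp only [smul_eq_mul]; ring
  rw [e1, e2] at key
  linarith

/-! ### Integration by parts and interpolation for Gaussian vectors -/

section Pi

variable {ι : Type*} [Fintype ι]

/-- Resampling one coordinate of a standard Gaussian vector preserves its law. -/
theorem measurePreserving_update [DecidableEq ι] (i : ι) :
    MeasurePreserving (fun p : (ι → ℝ) × ℝ => Function.update p.1 i p.2)
      ((stdPi ι).prod (gaussianReal 0 1)) (stdPi ι) := by
  have hm : Measurable (fun p : (ι → ℝ) × ℝ => Function.update p.1 i p.2) := by
    refine measurable_pi_lambda _ fun j => ?_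
    by_cases h : j = i
    · subst h; simpa using measurable_snd
    · simp only [Function.update_of_ne h]
      exact (measurable_pi_apply j).comp measurable_fst
  refine ⟨hm, (Measure.pi_eq fun s hs => ?_).symm⟩
  rw [Measure.map_apply hm (MeasurableSet.univ_pi hs)]
  -- The preimage of a box is again a box: side `i` becomes free, hence of mass one, and its
  -- constraint passes to the fresh coordinate.
  have : (fun p : (ι → ℝ) × ℝ => Function.update p.1 i p.2) ⁻¹' Set.univ.pi s =
      (Set.univ.pi (Function.update s i Set.univ)) ×ˢ s i := by
    ext p
    simp only [Set.mem_preimage, Set.mem_pi, Set.mem_univ, forall_true_left, Set.mem_prod]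
    constructor
    · intro h
      refine ⟨fun j => ?_, by simpa using h i⟩
      by_cases hj : j = i
      · subst hj; simp
      · simpa [Function.update_of_ne hj] using h j
    · rintro ⟨h, h'⟩ j
      by_cases hj : j = i
      · subst hj; simpa using h'
      · simpa [Function.update_of_ne hj] using h j
  rw [this, Measure.prod_prod, Measure.pi_pi, ← Finset.mul_prod_erase _ _ (Finset.mem_univ i),
    ← Finset.mul_prod_erase (a := i) (f := fun j => gaussianReal 0 1 (s j)) _ (Finset.mem_univ i)]
  simp only [Function.update_self, measure_univ, one_mul]
  rw [mul_comm]
  congr 1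
  refine Finset.prod_congr rfl fun j hj => ?_
  rw [Function.update_of_ne (Finset.ne_of_mem_erase hj)]

theorem measurePreserving_eval_stdPi (i : ι) :
    MeasurePreserving (fun z : ι → ℝ => z i) (stdPi ι) (gaussianReal 0 1) :=
  measurePreserving_eval (fun _ => gaussianReal 0 1) i

theorem integrable_eval_stdPi (i : ι) : Integrable (fun z : ι → ℝ => z i) (stdPi ι) :=
  (measurePreserving_eval_stdPi i).integrable_comp_of_integrable integrable_id_gaussianReal

/-- Gaussian integration by parts in one coordinate of a standard Gaussian vector. -/
theorem integral_eval_mul_stdPi [DecidableEq ι] (i : ι) {G G' : (ι → ℝ) → ℝ}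
    (hG : Continuous G) (hG' : Continuous G')
    (hd : ∀ z, HasDerivAt (fun s => G (Function.update z i s)) (G' z) (z i))
    {C : ℝ} (hC : ∀ z, |G z| ≤ C) (hC' : ∀ z, |G' z| ≤ C) :
    ∫ z, z i * G z ∂(stdPi ι) = ∫ z, G' z ∂(stdPi ι) := by
  have i1 : Integrable (fun z => z i * G z) (stdPi ι) :=
    (integrable_eval_stdPi i).mul_bdd (c := C) hG.aestronglyMeasurable (ae_of_all _ hC)
  have i2 : Integrable G' (stdPi ι) :=
    (integrable_const C).mono' hG'.aestronglyMeasurable (ae_of_all _ hC')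
  have mp := measurePreserving_update i
  -- Resampling coordinate `i` and applying Fubini reduces the claim to the one-dimensional identity
  -- with the other coordinates frozen.
  rw [← mp.map_eq, integral_map mp.measurable.aemeasurable, integral_map mp.measurable.aemeasurable,
    integral_prod, integral_prod]
  · refine integral_congr_ae (ae_of_all _ fun z => ?_)
    simp only [Function.update_self]
    refine integral_id_mul_gaussianReal (fun s => ?_) ?_ (C := C) (fun _ => hC _) (fun _ => hC' _)
    · simpa using hd (Function.update z i s)
    · exact hG'.comp (continuous_const.update i continuous_id)
  · exact mp.integrable_comp_of_integrable i2
  · exact mp.integrable_comp_of_integrable i1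
  · rw [mp.map_eq]; exact i2.aestronglyMeasurable
  · rw [mp.map_eq]; exact i1.aestronglyMeasurable

/-- A linear map between coordinate spaces given by its coefficients. -/
def lin {κ : Type*} (c : κ → ι → ℝ) (z : ι → ℝ) : κ → ℝ := fun a => ∑ i, c a i * z i

theorem continuous_lin {κ : Type*} (c : κ → ι → ℝ) : Continuous (lin c) := by
  unfold lin; fun_prop

variable {κ : Type*} [Fintype κ]

/-- Gaussian integration by parts for a function of a linear image. -/
theorem integral_eval_mul_comp_lin (c : κ → ι → ℝ) {H : (κ → ℝ) → ℝ} {H' : κ → (κ → ℝ) → ℝ}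
    (hH : ∀ z, HasFDerivAt H
      (∑ b, H' b z • (ContinuousLinearMap.proj b : (κ → ℝ) →L[ℝ] ℝ)) z)
    (hc : ∀ b, Continuous (H' b)) {C : ℝ} (hC : ∀ z, |H z| ≤ C) (hC' : ∀ b z, |H' b z| ≤ C)
    (i : ι) :
    ∫ z, z i * H (lin c z) ∂(stdPi ι) = ∑ b, c b i * ∫ z, H' b (lin c z) ∂(stdPi ι) := by
  classical
  have hcont : Continuous H := continuous_iff_continuousAt.2 fun z => (hH z).continuousAt
  have hb : ∀ b z, |c b i * H' b (lin c z)| ≤ |c b i| * C := fun b z => by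
    rw [abs_mul]; exact mul_le_mul_of_nonneg_left (hC' _ _) (abs_nonneg _)
  have hcb : ∀ b, Continuous fun z => c b i * H' b (lin c z) := fun b =>
    continuous_const.mul ((hc b).comp (continuous_lin c))
  rw [integral_eval_mul_stdPi i (G := fun z => H (lin c z))
    (G' := fun z => ∑ b, c b i * H' b (lin c z)) (C := |C| + ∑ b, |c b i| * C)
    (hcont.comp (continuous_lin c)) (continuous_finsetSum _ fun b _ => hcb b)]
  · rw [integral_finsetSum]
    · simp_rw [integral_const_mul]
    · intro b _
      exact (integrable_const (|c b i| * C)).mono' (hcb b).aestronglyMeasurable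
        (ae_of_all _ (hb b))
  · intro z
    have hl : HasDerivAt (fun s => lin c (Function.update z i s)) (fun a => c a i) (z i) := by
      rw [hasDerivAt_pi]
      intro a
      unfold lin
      have : ∀ j ∈ Finset.univ, HasDerivAt (fun s => c a j * Function.update z i s j)
          (c a j * (Pi.single i (1 : ℝ) : ι → ℝ) j) (z i) := fun j _ =>
        ((hasDerivAt_pi.1 (hasDerivAt_update z i (z i))) j).const_mul _
      refine (HasDerivAt.fun_sum this).congr_deriv ?_
      simp [Pi.single_apply]
    have e : lin c (Function.update z i (z i)) = lin c z := by rw [Function.update_eq_self]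
    have := HasFDerivAt.comp_hasDerivAt (z i) (by rw [e]; exact hH (lin c z)) hl
    refine this.congr_deriv ?_
    simp [mul_comm]
  · intro z
    have : 0 ≤ ∑ b, |c b i| * C :=
      Finset.sum_nonneg fun b _ => (abs_nonneg _).trans (hb b z)
    linarith [hC (lin c z), le_abs_self C]
  · intro z
    refine (Finset.abs_sum_le_sum_abs _ _).trans ?_
    have := Finset.sum_le_sum fun b (_ : b ∈ Finset.univ) => hb b z
    linarith [abs_nonneg C]

/-- Gaussian comparison by interpolation: if the Hessian of `F` has, entry by entry, the sign
opposite to that of the covariance difference, the expectation of `F` decreases. -/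
theorem integral_comp_lin_le (c c' : κ → ι → ℝ) (horth : ∀ a b, ∑ i, c a i * c' b i = 0)
    {F : (κ → ℝ) → ℝ} {D : κ → (κ → ℝ) → ℝ} {DD : κ → κ → (κ → ℝ) → ℝ}
    (hF : ∀ z, HasFDerivAt F
      (∑ a, D a z • (ContinuousLinearMap.proj a : (κ → ℝ) →L[ℝ] ℝ)) z)
    (hD : ∀ a z, HasFDerivAt (D a)
      (∑ b, DD a b z • (ContinuousLinearMap.proj b : (κ → ℝ) →L[ℝ] ℝ)) z)
    (hDD : ∀ a b, Continuous (DD a b)) {C : ℝ} (hCF : ∀ z, |F z| ≤ C)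
    (hCD : ∀ a z, |D a z| ≤ C) (hCDD : ∀ a b z, |DD a b z| ≤ C)
    (hsign : ∀ a b z, (∑ i, c' a i * c' b i - ∑ i, c a i * c b i) * DD a b z ≤ 0) :
    ∫ z, F (lin c' z) ∂(stdPi ι) ≤ ∫ z, F (lin c z) ∂(stdPi ι) := by
  -- A quarter-circle path from `c` at `θ = 0` to `c'` at `θ = π/2`; `K'` is its velocity.
  set K : ℝ → κ → ι → ℝ := fun θ a i => Real.cos θ * c a i + Real.sin θ * c' a i with hK
  set K' : ℝ → κ → ι → ℝ := fun θ a i => -Real.sin θ * c a i + Real.cos θ * c' a i with hK'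
  have hFc : Continuous F := continuous_iff_continuousAt.2 fun z => (hF z).continuousAt
  have hDc : ∀ a, Continuous (D a) := fun a =>
    continuous_iff_continuousAt.2 fun z => (hD a z).continuousAt
  set u : ℝ → ℝ := fun θ => ∫ z, F (lin (K θ) z) ∂(stdPi ι) with hu
  have hlin : ∀ θ z, HasDerivAt (fun θ => lin (K θ) z) (lin (K' θ) z) θ := by
    intro θ z
    rw [hasDerivAt_pi]
    intro a
    refine HasDerivAt.fun_sum fun i _ => HasDerivAt.mul_const ?_ _
    exact ((Real.hasDerivAt_cos θ).mul_const _).add ((Real.hasDerivAt_sin θ).mul_const _)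
  have hbK : ∀ θ a i, |K' θ a i| ≤ |c a i| + |c' a i| := by
    intro θ a i
    refine (abs_add_le _ _).trans ?_
    rw [abs_mul, abs_mul, abs_neg]
    exact add_le_add (mul_le_of_le_one_left (abs_nonneg _) (Real.abs_sin_le_one θ))
      (mul_le_of_le_one_left (abs_nonneg _) (Real.abs_cos_le_one θ))
  have hderiv : ∀ θ, HasDerivAt u
      (∫ z, ∑ a, D a (lin (K θ) z) * lin (K' θ) z a ∂(stdPi ι)) θ := by
    intro θ
    refine (hasDerivAt_integral_of_dominated_loc_of_deriv_le (μ := stdPi ι)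
      (F := fun θ z => F (lin (K θ) z))
      (F' := fun θ z => ∑ a, D a (lin (K θ) z) * lin (K' θ) z a)
      (bound := fun z => ∑ a, C * ∑ i, (|c a i| + |c' a i|) * |z i|)
      (s := Set.univ) (x₀ := θ) univ_mem ?_ ?_ ?_ ?_ ?_ ?_).2
    · exact Eventually.of_forall fun θ =>
        (hFc.comp (continuous_lin _)).aestronglyMeasurable
    · exact (integrable_const C).mono' (hFc.comp (continuous_lin _)).aestronglyMeasurable
        (ae_of_all _ fun z => hCF _)
    · refine Continuous.aestronglyMeasurable ?_
      exact continuous_finsetSum _ fun a _ => ((hDc a).comp (continuous_lin _)).mul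
        ((continuous_apply a).comp (continuous_lin _))
    · refine ae_of_all _ fun z θ _ => ?_
      refine (Finset.abs_sum_le_sum_abs _ _).trans (Finset.sum_le_sum fun a _ => ?_)
      rw [abs_mul]
      refine mul_le_mul (hCD _ _) ?_ (abs_nonneg _) ((abs_nonneg _).trans (hCD a 0))
      refine (Finset.abs_sum_le_sum_abs _ _).trans (Finset.sum_le_sum fun i _ => ?_)
      rw [abs_mul]
      exact mul_le_mul_of_nonneg_right (hbK _ _ _) (abs_nonneg _)
    · refine integrable_finsetSum _ fun a _ => Integrable.const_mul ?_ _
      exact integrable_finsetSum _ fun i _ => (integrable_eval_stdPi i).abs.const_mul _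
    · refine ae_of_all _ fun z θ _ => ?_
      refine ((hF (lin (K θ) z)).comp_hasDerivAt θ (hlin θ z)).congr_deriv ?_
      simp
  have hval : ∀ θ, (∫ z, ∑ a, D a (lin (K θ) z) * lin (K' θ) z a ∂(stdPi ι)) =
      ∑ a, ∑ b, Real.sin θ * Real.cos θ * ∫ z,
        (∑ i, c' a i * c' b i - ∑ i, c a i * c b i) * DD a b (lin (K θ) z) ∂(stdPi ι) := by
    intro θ
    have hi : ∀ a i, Integrable (fun z => z i * D a (lin (K θ) z)) (stdPi ι) := fun a i =>
      (integrable_eval_stdPi i).mul_bdd (c := C)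
        ((hDc a).comp (continuous_lin _)).aestronglyMeasurable (ae_of_all _ fun z => hCD _ _)
    have e1 : ∀ z, ∑ a, D a (lin (K θ) z) * lin (K' θ) z a =
        ∑ a, ∑ i, K' θ a i * (z i * D a (lin (K θ) z)) := by
      intro z
      refine Finset.sum_congr rfl fun a _ => ?_
      rw [lin, Finset.mul_sum]
      exact Finset.sum_congr rfl fun i _ => by ring
    simp_rw [e1]
    rw [integral_finsetSum _ fun a _ => integrable_finsetSum _ fun i _ => (hi a i).const_mul _]
    refine Finset.sum_congr rfl fun a _ => ?_
    rw [integral_finsetSum _ fun i _ => (hi a i).const_mul _]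
    have e2 : ∀ i, ∫ z, K' θ a i * (z i * D a (lin (K θ) z)) ∂(stdPi ι) =
        ∑ b, K' θ a i * K θ b i * ∫ z, DD a b (lin (K θ) z) ∂(stdPi ι) := by
      intro i
      rw [integral_const_mul, integral_eval_mul_comp_lin (K θ) (hD a) (hDD a) (hCD a)
        (hCDD a) i, Finset.mul_sum]
      exact Finset.sum_congr rfl fun b _ => by ring
    simp_rw [e2]
    rw [Finset.sum_comm]
    refine Finset.sum_congr rfl fun b _ => ?_
    rw [integral_const_mul, ← Finset.sum_mul, ← mul_assoc]
    congr 1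
    -- Summed over `i`, the last bracket vanishes by `horth`; what remains is the covariance
    -- difference times `sin θ cos θ`, which is nonnegative on the path.
    have e3 : ∀ i, K' θ a i * K θ b i =
        Real.sin θ * Real.cos θ * (c' a i * c' b i - c a i * c b i)
          + (Real.cos θ ^ 2 * (c b i * c' a i) - Real.sin θ ^ 2 * (c a i * c' b i)) := by
      intro i; simp only [hK, hK']; ring
    simp_rw [e3]
    rw [Finset.sum_add_distrib, Finset.sum_sub_distrib, ← Finset.mul_sum, ← Finset.mul_sum,
      ← Finset.mul_sum, horth, horth, Finset.sum_sub_distrib]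
    ring
  have hanti : AntitoneOn u (Set.Icc 0 (Real.pi / 2)) := by
    refine antitoneOn_of_deriv_nonpos (convex_Icc _ _)
      (fun θ _ => (hderiv θ).continuousAt.continuousWithinAt)
      (fun θ _ => (hderiv θ).differentiableAt.differentiableWithinAt) fun θ hθ => ?_
    rw [interior_Icc] at hθ
    rw [(hderiv θ).deriv, hval]
    refine Finset.sum_nonpos fun a _ => Finset.sum_nonpos fun b _ => ?_
    refine mul_nonpos_of_nonneg_of_nonpos (mul_nonneg ?_ ?_) (integral_nonpos fun z => hsign a b _)
    · exact Real.sin_nonneg_of_nonneg_of_le_pi hθ.1.le (by linarith [hθ.2, Real.pi_pos])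
    · exact Real.cos_nonneg_of_neg_pi_div_two_le_of_le (by linarith [hθ.1, Real.pi_pos]) hθ.2.le
  have := hanti (Set.left_mem_Icc.2 (by positivity)) (Set.right_mem_Icc.2 (by positivity))
    (by positivity : (0 : ℝ) ≤ Real.pi / 2)
  simpa [hu, hK] using this

end Pi

/-! ### Bounded `C¹` functions and the smooth cutoff -/

section BddC1

variable {E : Type*} [NormedAddCommGroup E] [NormedSpace ℝ E]

/-- Continuously differentiable functions that are bounded together with their derivative. -/
def BddC1 (G : E → ℝ) : Prop :=
  ContDiff ℝ 1 G ∧ ∃ C, ∀ z, |G z| ≤ C ∧ ‖fderiv ℝ G z‖ ≤ C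

theorem BddC1.const (r : ℝ) : BddC1 (fun _ : E => r) :=
  ⟨contDiff_const, |r|, fun z => by simp⟩

theorem BddC1.differentiable {G : E → ℝ} (hG : BddC1 G) : Differentiable ℝ G :=
  hG.1.differentiable one_ne_zero

theorem BddC1.neg {G : E → ℝ} (hG : BddC1 G) : BddC1 (fun z => -G z) := by
  obtain ⟨C, hC⟩ := hG.2
  refine ⟨hG.1.neg, C, fun z => ⟨by simpa using (hC z).1, ?_⟩⟩
  rw [fderiv_fun_neg, norm_neg]
  exact (hC z).2

theorem BddC1.const_sub {G : E → ℝ} (hG : BddC1 G) (r : ℝ) : BddC1 (fun z => r - G z) := by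
  obtain ⟨C, hC⟩ := hG.2
  refine ⟨contDiff_const.sub hG.1, |r| + C, fun z => ⟨?_, ?_⟩⟩
  · exact (abs_sub _ _).trans (add_le_add le_rfl (hC z).1)
  · rw [fderiv_const_sub, norm_neg]
    linarith [(hC z).2, abs_nonneg r]

theorem BddC1.mul {G H : E → ℝ} (hG : BddC1 G) (hH : BddC1 H) : BddC1 (fun z => G z * H z) := by
  obtain ⟨C, hC⟩ := hG.2
  obtain ⟨C', hC'⟩ := hH.2
  refine ⟨hG.1.mul hH.1, C * C' + C * C' + C * C', fun z => ?_⟩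
  have h0 : 0 ≤ C := (abs_nonneg _).trans (hC z).1
  have h0' : 0 ≤ C' := (abs_nonneg _).trans (hC' z).1
  have h1 : |G z * H z| ≤ C * C' := by
    rw [abs_mul]; exact mul_le_mul (hC z).1 (hC' z).1 (abs_nonneg _) h0
  refine ⟨by nlinarith, ?_⟩
  rw [fderiv_fun_mul (hG.differentiable z) (hH.differentiable z)]
  refine (norm_add_le _ _).trans ?_
  rw [norm_smul, norm_smul, Real.norm_eq_abs, Real.norm_eq_abs]
  have h2 := mul_le_mul (hC z).1 (hC' z).2 (norm_nonneg _) h0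
  have h3 := mul_le_mul (hC' z).1 (hC z).2 (norm_nonneg _) h0'
  nlinarith

theorem BddC1.prod {α : Type*} (s : Finset α) {G : α → E → ℝ} (hG : ∀ i ∈ s, BddC1 (G i)) :
    BddC1 (fun z => ∏ i ∈ s, G i z) := by
  classical
  induction s using Finset.induction_on with
  | empty => simpa using BddC1.const 1
  | insert i s hi ih =>
    simp_rw [Finset.prod_insert hi]
    exact (hG i (Finset.mem_insert_self _ _)).mul
      (ih fun j hj => hG j (Finset.mem_insert_of_mem hj))

theorem BddC1.comp_proj {κ : Type*} [Fintype κ] {h : ℝ → ℝ} (hh : ContDiff ℝ 1 h) {C : ℝ}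
    (hC : ∀ t, |h t| ≤ C) (hC' : ∀ t, |deriv h t| ≤ C) (a : κ) :
    BddC1 (fun z : κ → ℝ => h (z a)) := by
  refine ⟨hh.comp (contDiff_apply ℝ ℝ a), C, fun z => ⟨hC _, ?_⟩⟩
  have hd : HasFDerivAt (fun z : κ → ℝ => h (z a))
      (deriv h (z a) • (ContinuousLinearMap.proj a : (κ → ℝ) →L[ℝ] ℝ)) z :=
    ((hh.differentiable one_ne_zero (z a)).hasDerivAt).comp_hasFDerivAt z (hasFDerivAt_apply a z)
  rw [hd.fderiv, norm_smul]
  have : ‖(ContinuousLinearMap.proj a : (κ → ℝ) →L[ℝ] ℝ)‖ ≤ 1 :=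
    ContinuousLinearMap.opNorm_le_bound _ zero_le_one fun z => by
      simpa using norm_le_pi_norm z a
  calc ‖deriv h (z a)‖ * _ ≤ ‖deriv h (z a)‖ * 1 :=
        mul_le_mul_of_nonneg_left this (norm_nonneg _)
    _ ≤ C := by simpa using hC' _

theorem clm_pi_eq_sum {κ : Type*} [Fintype κ] [DecidableEq κ] (T : (κ → ℝ) →L[ℝ] ℝ) :
    T = ∑ b, T (Pi.single b 1) • (ContinuousLinearMap.proj b : (κ → ℝ) →L[ℝ] ℝ) := by
  ext z
  have h1 : ∀ b : κ, (fun j => if b = j then (1 : ℝ) else 0) = Pi.single b 1 := fun b => by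
    ext j; simp [Pi.single_apply, eq_comm]
  have := LinearMap.pi_apply_eq_sum_univ (T : (κ → ℝ) →ₗ[ℝ] ℝ) z
  simp only [h1] at this
  simpa [mul_comm] using this

end BddC1

/-- A smooth nonincreasing cutoff between two levels. -/
theorem exists_smooth_cutoff {l l' : ℝ} (hl : l < l') :
    ∃ h : ℝ → ℝ, ∃ C : ℝ, ContDiff ℝ 1 h ∧ ContDiff ℝ 1 (deriv h) ∧ Antitone h ∧
      (∀ t, 0 ≤ h t) ∧ (∀ t, h t ≤ 1) ∧ (∀ t ≤ l, h t = 1) ∧ (∀ t, l' ≤ t → h t = 0) ∧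
      (∀ t, |deriv h t| ≤ C) ∧ ∀ t, |deriv (deriv h) t| ≤ C := by
  have hpos : 0 < l' - l := sub_pos.2 hl
  set h : ℝ → ℝ := fun t => 1 - Real.smoothTransition ((t - l) / (l' - l)) with hh
  have hc : ContDiff ℝ 2 h :=
    contDiff_const.sub (Real.smoothTransition.contDiff.comp
      ((contDiff_id.sub contDiff_const).div_const _))
  have hc' : ContDiff ℝ 1 (deriv h) := by
    have : ContDiff ℝ (1 + 1) h := by simpa [one_add_one_eq_two] using hc
    exact (contDiff_succ_iff_deriv.1 this).2.2
  have hone : ∀ t ≤ l, h t = 1 := fun t ht => by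
    simp only [hh]
    rw [Real.smoothTransition.zero_of_nonpos
      (div_nonpos_of_nonpos_of_nonneg (by linarith) hpos.le), sub_zero]
  have hzero : ∀ t, l' ≤ t → h t = 0 := fun t ht => by
    simp only [hh]
    rw [Real.smoothTransition.one_of_one_le ((one_le_div hpos).2 (by linarith)), sub_self]
  have hd1 : ∀ t ∈ Set.Iio l, deriv h t = 0 := fun t ht => by
    have : h =ᶠ[𝓝 t] fun _ => 1 := by
      filter_upwards [Iio_mem_nhds ht] with s hs using hone s (le_of_lt hs)
    rw [this.deriv_eq, deriv_const]
  have hd2 : ∀ t ∈ Set.Ioi l', deriv h t = 0 := fun t ht => by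
    have : h =ᶠ[𝓝 t] fun _ => 0 := by
      filter_upwards [Ioi_mem_nhds ht] with s hs using hzero s (le_of_lt hs)
    rw [this.deriv_eq, deriv_const]
  have hdd1 : ∀ t ∈ Set.Iio l, deriv (deriv h) t = 0 := fun t ht => by
    have : deriv h =ᶠ[𝓝 t] fun _ => 0 := by
      filter_upwards [Iio_mem_nhds ht] with s hs using hd1 s hs
    rw [this.deriv_eq, deriv_const]
  have hdd2 : ∀ t ∈ Set.Ioi l', deriv (deriv h) t = 0 := fun t ht => by
    have : deriv h =ᶠ[𝓝 t] fun _ => 0 := by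
      filter_upwards [Ioi_mem_nhds ht] with s hs using hd2 s hs
    rw [this.deriv_eq, deriv_const]
  have bound : ∀ k : ℝ → ℝ, Continuous k → (∀ t ∈ Set.Iio l, k t = 0) →
      (∀ t ∈ Set.Ioi l', k t = 0) → ∃ C, 0 ≤ C ∧ ∀ t, |k t| ≤ C := by
    intro k hk h1 h2
    obtain ⟨C, hC⟩ := (isCompact_Icc (a := l) (b := l')).exists_bound_of_continuousOn
      hk.continuousOn
    have hC0 : 0 ≤ C := (norm_nonneg _).trans (hC l (Set.left_mem_Icc.2 hl.le))
    refine ⟨C, hC0, fun t => ?_⟩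
    rcases lt_or_ge t l with ht | ht
    · simpa [h1 t ht] using hC0
    rcases lt_or_ge l' t with ht' | ht'
    · simpa [h2 t ht'] using hC0
    · exact hC t ⟨ht, ht'⟩
  obtain ⟨C₁, h1, hC₁⟩ := bound _ hc'.continuous hd1 hd2
  obtain ⟨C₂, h2, hC₂⟩ := bound _ (hc'.continuous_deriv le_rfl) hdd1 hdd2
  refine ⟨h, C₁ + C₂, hc.of_le (by norm_num), hc', ?_, ?_, ?_, hone, hzero, ?_, ?_⟩
  · intro s t hst
    exact sub_le_sub_left (Real.smoothTransition.monotone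
      (div_le_div_of_nonneg_right (by linarith) hpos.le)) _
  · exact fun t => sub_nonneg.2 (Real.smoothTransition.le_one _)
  · exact fun t => sub_le_self _ (Real.smoothTransition.nonneg _)
  · exact fun t => (hC₁ t).trans (by linarith)
  · exact fun t => (hC₂ t).trans (by linarith)

/-! ### Gordon's comparison inequality -/

section Gordon

variable {ι X Y : Type*} [Fintype ι] [Fintype X] [Fintype Y]

theorem prod_mem_Icc {α : Type*} (s : Finset α) {h : α → ℝ} (h0 : ∀ i, 0 ≤ h i)
    (h1 : ∀ i, h i ≤ 1) : 0 ≤ ∏ i ∈ s, h i ∧ ∏ i ∈ s, h i ≤ 1 :=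
  ⟨Finset.prod_nonneg fun i _ => h0 i, Finset.prod_le_one (fun i _ => h0 i) fun i _ => h1 i⟩

/-- Gordon's comparison inequality for finite families of Gaussian variables indexed by `X × Y`
whose covariances agree within each block `{x} × Y`. -/
theorem gordon_comparison (c c' : X × Y → ι → ℝ)
    (horth : ∀ a b, ∑ i, c a i * c' b i = 0)
    (hblock : ∀ x y y', ∑ i, c' (x, y) i * c' (x, y') i = ∑ i, c (x, y) i * c (x, y') i)
    (hcov : ∀ a b, ∑ i, c' a i * c' b i ≤ ∑ i, c a i * c b i) {l l' : ℝ} (hl : l < l') :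
    stdPi ι {z | ∃ x, ∀ y, lin c z (x, y) ≤ l} ≤
      stdPi ι {z | ∃ x, ∀ y, lin c' z (x, y) < l'} := by
  classical
  obtain ⟨h, C, hh, hh', hanti, h0, h1, hone, hzero, hC, hC'⟩ := exists_smooth_cutoff hl
  have hd : ∀ t, HasDerivAt h (deriv h t) t := fun t =>
    (hh.differentiable one_ne_zero t).hasDerivAt
  have hdneg : ∀ t, deriv h t ≤ 0 := fun t => hanti.deriv_nonpos
  have hC0 : 0 ≤ C := (abs_nonneg _).trans (hC 0)
  have hhB : ∀ a : X × Y, BddC1 (fun z : X × Y → ℝ => h (z a)) := fun a =>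
    BddC1.comp_proj (C := 1 + C) hh (fun t => by rw [abs_of_nonneg (h0 t)]; linarith [h1 t])
      (fun t => (hC t).trans (by linarith)) a
  have hhB' : ∀ a : X × Y, BddC1 (fun z : X × Y → ℝ => deriv h (z a)) := fun a =>
    BddC1.comp_proj (C := C) hh' hC hC' a
  -- `φ x` is 0 if all of block `x` is at most `l`, and 1 if some entry is at least `l'`. Thus `F =
  -- ∏ φ x` is 0 on the event of the left side and 1 off the event of the right side.
  set φ : X → (X × Y → ℝ) → ℝ := fun x z => 1 - ∏ y, h (z (x, y)) with hφ
  have hφB : ∀ x, BddC1 (φ x) := fun x =>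
    (BddC1.prod _ fun y _ => hhB (x, y)).const_sub 1
  have hφ01 : ∀ x z, 0 ≤ φ x z ∧ φ x z ≤ 1 := fun x z => by
    have := prod_mem_Icc Finset.univ (h := fun y => h (z (x, y))) (fun _ => h0 _) fun _ => h1 _
    simp only [hφ]
    constructor <;> linarith [this.1, this.2]
  set F : (X × Y → ℝ) → ℝ := fun z => ∏ x, φ x z with hF
  set D : X × Y → (X × Y → ℝ) → ℝ := fun a z =>
    (-deriv h (z a) * ∏ y ∈ Finset.univ.erase a.2, h (z (a.1, y))) *
      ∏ x ∈ Finset.univ.erase a.1, φ x z with hD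
  have hFB : BddC1 F := BddC1.prod _ fun x _ => hφB x
  have hDB : ∀ a, BddC1 (D a) := fun a =>
    (((hhB' a).neg).mul (BddC1.prod _ fun y _ => hhB (a.1, y))).mul
      (BddC1.prod _ fun x _ => hφB x)
  have hFd : ∀ z, HasFDerivAt F
      (∑ a, D a z • (ContinuousLinearMap.proj a : (X × Y → ℝ) →L[ℝ] ℝ)) z := by
    intro z
    have e1 : ∀ x, HasFDerivAt (φ x) (-∑ y, (∏ y' ∈ Finset.univ.erase y, h (z (x, y'))) •
        (deriv h (z (x, y)) • (ContinuousLinearMap.proj (x, y) : (X × Y → ℝ) →L[ℝ] ℝ))) z := by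
      intro x
      refine HasFDerivAt.const_sub ?_ 1
      refine HasFDerivAt.finsetProd fun y _ => ?_
      exact (hd _).comp_hasFDerivAt z (hasFDerivAt_apply (x, y) z)
    refine (HasFDerivAt.finsetProd fun x (_ : x ∈ Finset.univ) => e1 x).congr_fderiv ?_
    rw [Fintype.sum_prod_type]
    refine Finset.sum_congr rfl fun x _ => ?_
    rw [← Finset.sum_neg_distrib, Finset.smul_sum]
    refine Finset.sum_congr rfl fun y _ => ?_
    ext w
    simp [hD]
    ring
  choose C₂ hC₂ using fun a => (hDB a).2
  obtain ⟨C₁, hC₁⟩ := hFB.2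
  set M := |C₁| + ∑ a, |C₂ a| with hM
  have hM₂ : ∀ a, C₂ a ≤ M := fun a => by
    have := Finset.single_le_sum (f := fun a => |C₂ a|) (fun a _ => abs_nonneg _)
      (Finset.mem_univ a)
    linarith [le_abs_self (C₂ a), abs_nonneg C₁]
  have hM₁ : C₁ ≤ M := by
    have : 0 ≤ ∑ a, |C₂ a| := Finset.sum_nonneg fun a _ => abs_nonneg _
    linarith [le_abs_self C₁]
  have key : ∫ z, F (lin c' z) ∂(stdPi ι) ≤ ∫ z, F (lin c z) ∂(stdPi ι) := by
    -- Second derivatives are left abstract: boundedness comes from `BddC1`, and their sign from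
    -- monotonicity of `D`.
    refine integral_comp_lin_le c c' horth (D := D)
      (DD := fun a b z => fderiv ℝ (D a) z (Pi.single b 1)) (C := M) hFd ?_ ?_
      (fun z => (hC₁ z).1.trans hM₁) (fun a z => (hC₂ a z).1.trans (hM₂ a)) ?_ ?_
    · intro a z
      have := ((hDB a).differentiable z).hasFDerivAt
      exact this.congr_fderiv (clm_pi_eq_sum _)
    · intro a b
      exact ((hDB a).1.continuous_fderiv one_ne_zero).clm_apply continuous_const
    · intro a b z
      refine ((fderiv ℝ (D a) z).le_opNorm _).trans ?_
      rw [Pi.norm_single, norm_one, mul_one]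
      exact ((hC₂ a z).2).trans (hM₂ a)
    · rintro ⟨x, y⟩ ⟨x', y'⟩ z
      -- Within a block the covariances agree, so the Hessian sign is irrelevant there.
      by_cases hx : x = x'
      · subst hx
        rw [hblock, sub_self, zero_mul]
      refine mul_nonpos_of_nonpos_of_nonneg (sub_nonpos.2 (hcov _ _)) ?_
      -- Across blocks, moving coordinate `(x', y')` leaves the nonnegative factor from block `x`
      -- fixed and can only increase the other `φ`, as `h` is antitone; so the mixed derivative is
      -- nonnegative.
      have hline : HasDerivAt (fun s : ℝ => z + s • (Pi.single (x', y') 1 : X × Y → ℝ))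
          (Pi.single (x', y') 1) 0 := by
        simpa using ((hasDerivAt_id (0 : ℝ)).smul_const
          (Pi.single (x', y') 1 : X × Y → ℝ)).const_add z
      have hcomp : HasDerivAt
          (fun s : ℝ => D (x, y) (z + s • (Pi.single (x', y') 1 : X × Y → ℝ)))
          (fderiv ℝ (D (x, y)) z (Pi.single (x', y') 1)) 0 :=
        HasFDerivAt.comp_hasDerivAt (l := D (x, y)) (l' := fderiv ℝ (D (x, y)) z) (0 : ℝ)
          (by simpa using ((hDB (x, y)).differentiable z).hasFDerivAt) hline
      refine hcomp.nonneg_of_monotone fun s t hst => ?_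
      have hsame : ∀ (r : ℝ) (y₀ : Y),
          (z + r • (Pi.single (x', y') 1 : X × Y → ℝ)) (x, y₀) = z (x, y₀) := by
        intro r y₀
        simp [hx]
      simp only [hD, hsame]
      refine mul_le_mul_of_nonneg_left ?_ (mul_nonneg (neg_nonneg.2 (hdneg _))
        (Finset.prod_nonneg fun _ _ => h0 _))
      refine Finset.prod_le_prod (fun x₁ _ => (hφ01 _ _).1) fun x₁ _ => ?_
      refine sub_le_sub_left (Finset.prod_le_prod (fun _ _ => h0 _) fun y₁ _ => hanti ?_) _
      simp only [Pi.add_apply, Pi.smul_apply, smul_eq_mul]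
      refine add_le_add le_rfl (mul_le_mul_of_nonneg_right hst ?_)
      rw [Pi.single_apply]; split_ifs <;> norm_num
  have hFc : Continuous F := hFB.1.continuous
  have hF01 : ∀ z, 0 ≤ F z ∧ F z ≤ 1 := fun z =>
    prod_mem_Icc _ (fun x => (hφ01 x z).1) fun x => (hφ01 x z).2
  have hint : ∀ c : X × Y → ι → ℝ, Integrable (fun z => F (lin c z)) (stdPi ι) := fun c =>
    (integrable_const (1 : ℝ)).mono' (hFc.comp (continuous_lin c)).aestronglyMeasurable
      (ae_of_all _ fun z => by
        rw [Real.norm_eq_abs, abs_of_nonneg (hF01 _).1]; exact (hF01 _).2)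
  have hco : ∀ (c : X × Y → ι → ℝ) x y, Continuous fun z => lin c z (x, y) := fun c x y =>
    (continuous_apply (x, y)).comp (continuous_lin c)
  have hS : MeasurableSet {z | ∃ x, ∀ y, lin c z (x, y) ≤ l} := by
    simp only [Set.ofPred_exists, Set.ofPred_forall]
    exact MeasurableSet.iUnion fun x => MeasurableSet.iInter fun y =>
      (isClosed_le (hco c x y) continuous_const).measurableSet
  have hS' : MeasurableSet {z | ∃ x, ∀ y, lin c' z (x, y) < l'} := by
    simp only [Set.ofPred_exists, Set.ofPred_forall]
    exact MeasurableSet.iUnion fun x => MeasurableSet.iInter fun y =>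
      (isOpen_lt (hco c' x y) continuous_const).measurableSet
  have up : ∫ z, F (lin c z) ∂(stdPi ι) ≤
      (stdPi ι).real {z | ∃ x, ∀ y, lin c z (x, y) ≤ l}ᶜ := by
    rw [← integral_indicator_one hS.compl]
    refine integral_mono (hint c) ((integrable_const (1 : ℝ)).indicator hS.compl) fun z => ?_
    by_cases hz : z ∈ {z | ∃ x, ∀ y, lin c z (x, y) ≤ l}
    · have hz' : z ∉ {z | ∃ x, ∀ y, lin c z (x, y) ≤ l}ᶜ := fun hn => hn hz
      simp only [Set.indicator_of_notMem hz']
      obtain ⟨x, hx⟩ := hz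
      refine le_of_eq (Finset.prod_eq_zero (Finset.mem_univ x) ?_)
      simp only [hφ]
      rw [Finset.prod_eq_one fun y _ => hone _ (hx y), sub_self]
    · simp only [Set.indicator_of_mem (Set.mem_compl hz)]
      exact (hF01 _).2
  have down : (stdPi ι).real {z | ∃ x, ∀ y, lin c' z (x, y) < l'}ᶜ ≤
      ∫ z, F (lin c' z) ∂(stdPi ι) := by
    rw [← integral_indicator_one hS'.compl]
    refine integral_mono ((integrable_const (1 : ℝ)).indicator hS'.compl) (hint c') fun z => ?_
    by_cases hz : z ∈ {z | ∃ x, ∀ y, lin c' z (x, y) < l'}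
    · have hz' : z ∉ {z | ∃ x, ∀ y, lin c' z (x, y) < l'}ᶜ := fun hn => hn hz
      simp only [Set.indicator_of_notMem hz']
      exact (hF01 _).1
    · simp only [Set.indicator_of_mem (Set.mem_compl hz), Pi.one_apply]
      refine le_of_eq (Finset.prod_eq_one fun x _ => ?_).symm
      simp only [Set.mem_ofPred_eq, not_exists, not_forall, not_lt] at hz
      obtain ⟨y, hy⟩ := hz x
      simp only [hφ]
      rw [Finset.prod_eq_zero (Finset.mem_univ y) (hzero _ hy), sub_zero]
  have := down.trans (key.trans up)
  rw [measureReal_compl hS, measureReal_compl hS'] at this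
  refine (ENNReal.toReal_le_toReal (measure_ne_top _ _) (measure_ne_top _ _)).1 ?_
  simp only [measureReal_def] at this
  linarith

end Gordon

/-- Restricting a standard Gaussian vector to some of its coordinates. -/
theorem measurePreserving_comp_stdPi {ι κ : Type*} [Fintype ι] [Fintype κ] {e : κ → ι}
    (he : e.Injective) :
    MeasurePreserving (fun (z : ι → ℝ) k => z (e k)) (stdPi ι) (stdPi κ) := by
  have hi : iIndepFun (fun (i : ι) (z : ι → ℝ) => z i) (stdPi ι) :=
    iIndepFun_pi (X := fun (_ : ι) (t : ℝ) => t) fun _ => aemeasurable_id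
  refine ⟨by fun_prop, ?_⟩
  rw [(iIndepFun_iff_map_fun_eq_pi_map fun k =>
    (measurable_pi_apply (e k)).aemeasurable).1 (hi.precomp he)]
  congr 1
  ext1 k
  exact (measurePreserving_eval_stdPi (e k)).map_eq

/-! ### Escape of a set from a random cone -/

section Escape

variable {N R : Type*} [Fintype N] [Fintype R]

/-- The bilinear form `yᵀ G x`. -/
def bilin (y : R → ℝ) (x : N → ℝ) (G : R × N → ℝ) : ℝ := ∑ p : R × N, y p.1 * x p.2 * G p

theorem continuous_bilin (y : R → ℝ) (x : N → ℝ) : Continuous (bilin y x) := by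
  unfold bilin; fun_prop

theorem sum_mul_le_one {α : Type*} [Fintype α] {u v : α → ℝ} (hu : ∑ i, u i ^ 2 ≤ 1)
    (hv : ∑ i, v i ^ 2 ≤ 1) : ∑ i, u i * v i ≤ 1 := by
  have : ∀ i ∈ Finset.univ, u i * v i ≤ (u i ^ 2 + v i ^ 2) / 2 := fun i _ => by
    nlinarith [sq_nonneg (u i - v i)]
  refine (Finset.sum_le_sum this).trans ?_
  rw [← Finset.sum_div, Finset.sum_add_distrib]
  linarith

/-- The Gaussian comparison for the process `yᵀ G x` over finite index sets. -/
theorem measure_bilin_le_finite {X Y : Type*} [Fintype X] [Fintype Y] (x : X → N → ℝ)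
    (hx : ∀ i, ∑ j, x i j ^ 2 = 1) (y : Y → R → ℝ) (hy : ∀ i, ∑ r, y i r ^ 2 ≤ 1)
    {δ : ℝ} (hδ : 0 < δ) (c : ℝ) :
    stdPi (R × N) {G | ∃ a, ∀ b, bilin (y b) (x a) G < δ} ≤
      stdPi N {g | ∃ a, ∑ j, x a j * g j < -c} + stdPi R {h | ∀ b, ∑ r, y b r * h r < c + 3 * δ}
        + gaussianReal 0 1 {s | δ ≤ s} := by
  -- `k` encodes `yᵀGx + s`, the `Unit` coordinate being `s`; `k'` encodes `gᵀx + hᵀy`. They use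
  -- disjoint coordinates, hence are orthogonal.
  set k : X × Y → ((R × N) ⊕ Unit) ⊕ (N ⊕ R) → ℝ := fun a =>
    Sum.elim (Sum.elim (fun p => y a.2 p.1 * x a.1 p.2) fun _ => 1) fun _ => 0 with hk
  set k' : X × Y → ((R × N) ⊕ Unit) ⊕ (N ⊕ R) → ℝ := fun a =>
    Sum.elim (fun _ => 0) (Sum.elim (x a.1) (y a.2)) with hk'
  have hcov : ∀ a b, ∑ i, k a i * k b i =
      (∑ j, x a.1 j * x b.1 j) * (∑ r, y a.2 r * y b.2 r) + 1 := by
    intro a b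
    simp only [hk, Fintype.sum_sum_type, Sum.elim_inl, Sum.elim_inr, Finset.univ_unique,
      Finset.sum_singleton, mul_one, mul_zero, Finset.sum_const_zero, add_zero]
    rw [Fintype.sum_prod_type_right, Finset.sum_mul]
    congr 1
    refine Finset.sum_congr rfl fun j _ => ?_
    rw [Finset.mul_sum]
    exact Finset.sum_congr rfl fun r _ => by ring
  have hcov' : ∀ a b, ∑ i, k' a i * k' b i =
      (∑ j, x a.1 j * x b.1 j) + ∑ r, y a.2 r * y b.2 r := by
    intro a b
    simp [hk', Fintype.sum_sum_type]
  have hself : ∀ i, ∑ j, x i j * x i j = 1 := fun i => by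
    rw [← hx i]; exact Finset.sum_congr rfl fun j _ => by ring
  -- `yᵀGx < δ` and `s < δ` give level `2δ`; the third `δ` is the cutoff's gap. The covariances
  -- differ by `(1 - ⟨x,x'⟩)(1 - ⟨y,y'⟩) ≥ 0`, which vanishes for `x = x'` because `x` is a unit
  -- vector; `y` need not be.
  have hg := gordon_comparison k k' (l := 2 * δ) (l' := 3 * δ)
    (fun a b => by simp [hk, hk', Fintype.sum_sum_type])
    (fun i b b' => by rw [hcov, hcov', hself]; ring)
    (fun a b => by
      rw [hcov, hcov']
      have h1 := sum_mul_le_one (hx a.1).le (hx b.1).le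
      have h2 := sum_mul_le_one (hy a.2) (hy b.2)
      nlinarith [mul_nonneg (sub_nonneg.2 h1) (sub_nonneg.2 h2)])
    (by linarith)
  have mG := measurePreserving_comp_stdPi (ι := ((R × N) ⊕ Unit) ⊕ (N ⊕ R))
    (e := fun p : R × N => Sum.inl (Sum.inl p)) fun p q h => by simpa using h
  have mg := measurePreserving_comp_stdPi (ι := ((R × N) ⊕ Unit) ⊕ (N ⊕ R))
    (e := fun p : N => Sum.inr (Sum.inl p)) fun p q h => by simpa using h
  have mh := measurePreserving_comp_stdPi (ι := ((R × N) ⊕ Unit) ⊕ (N ⊕ R))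
    (e := fun p : R => Sum.inr (Sum.inr p)) fun p q h => by simpa using h
  have ms := measurePreserving_eval_stdPi (ι := ((R × N) ⊕ Unit) ⊕ (N ⊕ R))
    (Sum.inl (Sum.inr ()))
  have hlin : ∀ z a, lin k z a =
      bilin (y a.2) (x a.1) (fun p => z (Sum.inl (Sum.inl p))) + z (Sum.inl (Sum.inr ())) := by
    intro z a
    simp [lin, bilin, hk, Fintype.sum_sum_type]
  have hlin' : ∀ z a, lin k' z a =
      (∑ j, x a.1 j * z (Sum.inr (Sum.inl j))) + ∑ r, y a.2 r * z (Sum.inr (Sum.inr r)) := by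
    intro z a
    simp [lin, hk', Fintype.sum_sum_type]
  have oG : MeasurableSet {G : R × N → ℝ | ∃ a, ∀ b, bilin (y b) (x a) G < δ} := by
    simp only [Set.ofPred_exists, Set.ofPred_forall]
    exact MeasurableSet.iUnion fun a => MeasurableSet.iInter fun b =>
      (isOpen_lt (continuous_bilin _ _) continuous_const).measurableSet
  have og : MeasurableSet {g : N → ℝ | ∃ a, ∑ j, x a j * g j < -c} := by
    simp only [Set.ofPred_exists]
    exact MeasurableSet.iUnion fun a =>
      (isOpen_lt (by fun_prop) continuous_const).measurableSet
  have oh : MeasurableSet {h : R → ℝ | ∀ b, ∑ r, y b r * h r < c + 3 * δ} := by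
    simp only [Set.ofPred_forall]
    exact MeasurableSet.iInter fun b =>
      (isOpen_lt (by fun_prop) continuous_const).measurableSet
  have os : MeasurableSet {s : ℝ | δ ≤ s} := measurableSet_Ici
  rw [← mG.measure_preimage oG.nullMeasurableSet, ← mg.measure_preimage og.nullMeasurableSet,
    ← mh.measure_preimage oh.nullMeasurableSet, ← ms.measure_preimage os.nullMeasurableSet]
  refine (measure_mono ?_).trans ((measure_union_le _ _).trans
    (add_le_add (hg.trans ((measure_mono ?_).trans (measure_union_le _ _))) le_rfl))
  · rintro z ⟨a, ha⟩
    rcases le_or_gt δ (z (Sum.inl (Sum.inr ()))) with hs | hs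
    · exact Or.inr hs
    · refine Or.inl ⟨a, fun b => ?_⟩
      rw [hlin]
      linarith [ha b]
  · rintro z ⟨a, ha⟩
    by_cases hz : ∑ j, x a j * z (Sum.inr (Sum.inl j)) < -c
    · exact Or.inl ⟨a, hz⟩
    · refine Or.inr fun b => ?_
      have := ha b
      rw [hlin'] at this
      push Not at hz
      simp only at this
      linarith

/-- A union of open sets has measure at most that of its finite subunions. -/
theorem measure_biUnion_isOpen_le {α β : Type*} [TopologicalSpace α] [SecondCountableTopology α]
    [MeasurableSpace α] (μ : Measure α) (K : Set β) (U : β → Set α) (hU : ∀ x, IsOpen (U x))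
    {C : ENNReal} (hC : ∀ s : Finset β, (s : Set β) ⊆ K → μ (⋃ x ∈ s, U x) ≤ C) :
    μ (⋃ x ∈ K, U x) ≤ C := by
  classical
  obtain ⟨T, hTK, hT, hTU⟩ := TopologicalSpace.isOpen_biUnion_countable K U fun x _ => hU x
  rw [← hTU]
  have : ⋃ x ∈ T, U x = ⋃ s ∈ {s : Finset β | (s : Set β) ⊆ T}, ⋃ x ∈ s, U x := by
    ext a
    simp only [Set.mem_iUnion, exists_prop]
    constructor
    · rintro ⟨x, hx, ha⟩
      exact ⟨{x}, by simpa using hx, x, by simp, ha⟩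
    · rintro ⟨s, hs, x, hx, ha⟩
      exact ⟨x, hs hx, ha⟩
  -- The finite subunions form a countable directed family, so the measure of their union is the
  -- supremum of their measures.
  rw [this, measure_biUnion_eq_iSup]
  · exact iSup₂_le fun s hs => hC s (hs.trans hTK)
  · refine ((Set.countable_ofPred_finite_subset hT).preimage Finset.coe_injective).mono ?_
    exact fun s hs => ⟨s.finite_toSet, hs⟩
  · intro s hs t ht
    refine ⟨s ∪ t, by simpa using ⟨hs, ht⟩, ?_, ?_⟩
    · exact Set.biUnion_subset_biUnion_left fun x hx => Finset.mem_union_left _ hx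
    · exact Set.biUnion_subset_biUnion_left fun x hx => Finset.mem_union_right _ hx

/-- With finitely many `y` and strict inequalities, the event attached to each `x` is open, so
finite subsets of `K` suffice even when `K` is uncountable. -/
theorem measure_bilin_le {Y : Type*} [Fintype Y] (K : Set (N → ℝ))
    (hK : ∀ x ∈ K, ∑ j, x j ^ 2 = 1) (y : Y → R → ℝ) (hy : ∀ i, ∑ r, y i r ^ 2 ≤ 1)
    {δ : ℝ} (hδ : 0 < δ) (c : ℝ) :
    stdPi (R × N) {G | ∃ x ∈ K, ∀ b, bilin (y b) x G < δ} ≤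
      stdPi N {g | ∃ x ∈ K, ∑ j, x j * g j < -c} + stdPi R {h | ∀ b, ∑ r, y b r * h r < c + 3 * δ}
        + gaussianReal 0 1 {s | δ ≤ s} := by
  have e : {G | ∃ x ∈ K, ∀ b, bilin (y b) x G < δ} =
      ⋃ x ∈ K, {G : R × N → ℝ | ∀ b, bilin (y b) x G < δ} := by
    ext G; simp
  rw [e]
  refine measure_biUnion_isOpen_le _ _ _ (fun x => ?_) fun s hs => ?_
  · simp only [Set.ofPred_forall]
    exact isOpen_iInter_of_finite fun b => isOpen_lt (continuous_bilin _ _) continuous_const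
  · have := measure_bilin_le_finite (fun a : s => (a : N → ℝ)) (fun a => hK _ (hs a.2)) y hy hδ c
    refine le_trans (le_of_eq ?_) (this.trans ?_)
    · congr 1; ext G; simp
    · gcongr
      rintro ⟨⟨a, ha⟩, h⟩
      exact ⟨a, hs ha, h⟩

/-! ### Distance to the cone and its dual description -/

variable {R₁ R₂ : Type*} [Fintype R₁] [Fintype R₂]

/-- The squared distance to the cone `{h : h₁ = 0, h₂ ≤ 0}`. -/
def coneSq (h : R₁ ⊕ R₂ → ℝ) : ℝ :=
  ∑ r, h (Sum.inl r) ^ 2 + ∑ r, max (h (Sum.inr r)) 0 ^ 2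

theorem coneSq_nonneg (h : R₁ ⊕ R₂ → ℝ) : 0 ≤ coneSq h := by unfold coneSq; positivity

/-- The part of the unit ball dual to the cone `{v : v₁ = 0, v₂ ≤ 0}`. -/
def dualBall (R₁ R₂ : Type*) [Fintype R₁] [Fintype R₂] : Set (R₁ ⊕ R₂ → ℝ) :=
  {y | ∑ r, y r ^ 2 ≤ 1 ∧ ∀ r, 0 ≤ y (Sum.inr r)}

theorem zero_mem_dualBall : (0 : R₁ ⊕ R₂ → ℝ) ∈ dualBall R₁ R₂ := by simp [dualBall]

/-- The maximiser is the normalised residual `(h₁, h₂⁺)` of the projection onto the cone, or 0 if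
the residual vanishes. -/
theorem exists_mem_dualBall_eq_sqrt (h : R₁ ⊕ R₂ → ℝ) :
    ∃ y ∈ dualBall R₁ R₂, ∑ r, y r * h r = √(coneSq h) := by
  rcases (coneSq_nonneg h).eq_or_lt with h0 | h0
  · exact ⟨0, zero_mem_dualBall, by simp [← h0]⟩
  have hs : 0 < √(coneSq h) := Real.sqrt_pos.2 h0
  have hss : √(coneSq h) ^ 2 = coneSq h := Real.sq_sqrt h0.le
  set w : R₁ ⊕ R₂ → ℝ := Sum.elim (fun r => h (Sum.inl r)) fun r => max (h (Sum.inr r)) 0 with hw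
  refine ⟨fun r => w r / √(coneSq h), ⟨?_, fun r => ?_⟩, ?_⟩
  · simp_rw [div_pow]
    rw [← Finset.sum_div, hss, div_le_one h0]
    simp [hw, coneSq, Fintype.sum_sum_type]
  · simp only [hw, Sum.elim_inr]
    exact div_nonneg (le_max_right _ _) hs.le
  · have : ∑ r, w r * h r = coneSq h := by
      simp only [hw, coneSq, Fintype.sum_sum_type, Sum.elim_inl, Sum.elim_inr]
      congr 1
      · exact Finset.sum_congr rfl fun r _ => by ring
      · refine Finset.sum_congr rfl fun r _ => ?_
        rcases le_total (h (Sum.inr r)) 0 with hr | hr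
        · simp [max_eq_right hr]
        · rw [max_eq_left hr]; ring
    simp_rw [div_mul_eq_mul_div]
    rw [← Finset.sum_div, this, div_eq_iff hs.ne', ← sq, hss]

/-- Gordon's escape inequality for a random linear system of equations and inequalities. -/
theorem measure_escape_le (K : Set (N → ℝ)) (hK : ∀ x ∈ K, ∑ j, x j ^ 2 = 1)
    {δ : ℝ} (hδ : 0 < δ) (c : ℝ) :
    stdPi ((R₁ ⊕ R₂) × N) {G | ∃ x ∈ K, (∀ r, ∑ j, G (Sum.inl r, j) * x j = 0) ∧
        ∀ r, ∑ j, G (Sum.inr r, j) * x j ≤ 0} ≤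
      stdPi N {g | ∃ x ∈ K, ∑ j, x j * g j < -c} +
        stdPi (R₁ ⊕ R₂) {h | √(coneSq h) ≤ c + 3 * δ} + gaussianReal 0 1 {s | δ ≤ s} := by
  have : Nonempty (dualBall R₁ R₂) := ⟨⟨0, zero_mem_dualBall⟩⟩
  -- The comparison needs finitely many `y`: the first `k` terms of a dense sequence are used, then
  -- `k → ∞` by continuity from above.
  set y : ℕ → R₁ ⊕ R₂ → ℝ := fun k => (TopologicalSpace.denseSeq (dualBall R₁ R₂) k : _) with hy
  have hyT : ∀ k, y k ∈ dualBall R₁ R₂ := fun k =>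
    (TopologicalSpace.denseSeq (dualBall R₁ R₂) k).2
  set S : ℕ → Set (R₁ ⊕ R₂ → ℝ) := fun k => {h | ∀ b : Fin k, ∑ r, y b r * h r < c + 3 * δ}
    with hS
  have hSm : ∀ k, MeasurableSet (S k) := fun k => by
    simp only [hS, Set.ofPred_forall]
    exact MeasurableSet.iInter fun b =>
      (isOpen_lt (by fun_prop) continuous_const).measurableSet
  have hSa : Antitone S := fun k l hkl h hh b => hh (Fin.castLE hkl b)
  have hlim := tendsto_measure_iInter_atTop (μ := stdPi (R₁ ⊕ R₂))
    (fun k => (hSm k).nullMeasurableSet) hSa ⟨0, measure_ne_top _ _⟩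
  have hsub : ⋂ k, S k ⊆ {h | √(coneSq h) ≤ c + 3 * δ} := by
    intro h hh
    by_contra hn
    simp only [Set.mem_ofPred_eq, not_le] at hn
    obtain ⟨v, hv, hvs⟩ := exists_mem_dualBall_eq_sqrt h
    have ho : IsOpen {u : dualBall R₁ R₂ | c + 3 * δ < ∑ r, (u : R₁ ⊕ R₂ → ℝ) r * h r} :=
      isOpen_lt continuous_const (continuous_finsetSum _ fun r _ =>
        ((continuous_apply r).comp continuous_subtype_val).mul continuous_const)
    obtain ⟨k, hk⟩ := (TopologicalSpace.denseRange_denseSeq (dualBall R₁ R₂)).exists_mem_open ho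
      ⟨⟨v, hv⟩, hn.trans_eq hvs.symm⟩
    have := (Set.mem_iInter.1 hh (k + 1)) (Fin.last k)
    exact lt_asymm hk this
  refine le_trans ?_ (add_le_add (add_le_add le_rfl (measure_mono hsub)) le_rfl)
  refine ge_of_tendsto' ((hlim.const_add _).add_const _) fun k => ?_
  refine (measure_mono ?_).trans (measure_bilin_le K hK (fun b : Fin k => y b)
    (fun b => (hyT b).1) hδ c)
  rintro G ⟨x, hx, h1, h2⟩
  refine ⟨x, hx, fun b => lt_of_le_of_lt ?_ hδ⟩
  have e : bilin (y b) x G = ∑ r, y b r * ∑ j, G (r, j) * x j := by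
    rw [bilin, Fintype.sum_prod_type]
    refine Finset.sum_congr rfl fun r _ => ?_
    rw [Finset.mul_sum]
    exact Finset.sum_congr rfl fun j _ => by ring
  rw [e, Fintype.sum_sum_type]
  refine add_nonpos (le_of_eq (Finset.sum_eq_zero fun r _ => by rw [h1, mul_zero])) ?_
  exact Finset.sum_nonpos fun r _ => mul_nonpos_of_nonneg_of_nonpos ((hyT b).2 r) (h2 r)

end Escape

/-! ### Concentration of the cone distance -/

theorem memLp_sq_gaussianReal : MemLp (fun t : ℝ => t ^ 2) 2 (gaussianReal 0 1) := by
  rw [memLp_two_iff_integrable_sq (by fun_prop)]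
  have := (memLp_id_gaussianReal (μ := 0) (v := 1) 4).integrable_norm_pow (p := 4) (by norm_num)
  refine this.congr (ae_of_all _ fun t => ?_)
  simp only [id, Real.norm_eq_abs]
  rw [← pow_mul, ← abs_pow, abs_of_nonneg (by positivity)]

theorem memLp_posPart_sq_gaussianReal :
    MemLp (fun t : ℝ => max t 0 ^ 2) 2 (gaussianReal 0 1) := by
  refine memLp_sq_gaussianReal.mono (by fun_prop) (ae_of_all _ fun t => ?_)
  rw [Real.norm_eq_abs, Real.norm_eq_abs, abs_of_nonneg (by positivity),
    abs_of_nonneg (by positivity)]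
  rcases le_total t 0 with h | h
  · rw [max_eq_right h]; simpa using sq_nonneg t
  · rw [max_eq_left h]

theorem integral_sq_gaussianReal : ∫ t, t ^ 2 ∂(gaussianReal 0 1) = 1 := by
  have h := variance_fun_id_gaussianReal (μ := 0) (v := 1)
  rw [variance_of_integral_eq_zero (by fun_prop) (by simp)] at h
  simpa using h

/-- By symmetry the positive and negative parts contribute equally to the second moment 1. -/
theorem integral_posPart_sq_gaussianReal :
    ∫ t, max t 0 ^ 2 ∂(gaussianReal 0 1) = 1 / 2 := by
  have h1 : ∫ t, max (-t) 0 ^ 2 ∂(gaussianReal 0 1) = ∫ t, max t 0 ^ 2 ∂(gaussianReal 0 1) := by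
    conv_rhs => rw [← neg_zero (G := ℝ), ← gaussianReal_map_neg]
    rw [integral_map (by fun_prop) (by fun_prop)]
    simp
  have hi := memLp_posPart_sq_gaussianReal.integrable (by norm_num)
  have hi' : Integrable (fun t : ℝ => max (-t) 0 ^ 2) (gaussianReal 0 1) := by
    refine ((memLp_sq_gaussianReal.integrable (by norm_num)).sub hi).congr
      (ae_of_all _ fun t => ?_)
    simp only [Pi.sub_apply]
    rcases le_total t 0 with h | h
    · rw [max_eq_right h, max_eq_left (by linarith)]; ring
    · rw [max_eq_left h, max_eq_right (by linarith)]; ring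
  have h2 : ∫ t, (max t 0 ^ 2 + max (-t) 0 ^ 2) ∂(gaussianReal 0 1) = 1 := by
    rw [← integral_sq_gaussianReal]
    congr 1; ext t
    rcases le_total t 0 with h | h
    · rw [max_eq_right h, max_eq_left (by linarith)]; ring
    · rw [max_eq_left h, max_eq_right (by linarith)]; ring
  rw [integral_add hi hi', h1] at h2
  linarith

/-- Lower deviations of the squared distance to the cone `{h : h₁ = 0, h₂ ≤ 0}`. -/
theorem exists_measure_coneSq_le : ∃ V : ℝ, ∀ (p q : ℕ) (η : ℝ), 0 < η →
    stdPi (Fin p ⊕ Fin q) {h | coneSq h ≤ (p : ℝ) + (q : ℝ) / 2 - η} ≤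
      ENNReal.ofReal (V * ((p : ℝ) + q) / η ^ 2) := by
  set V₁ := Var[fun t : ℝ => t ^ 2; gaussianReal 0 1] with hV₁
  set V₂ := Var[fun t : ℝ => max t 0 ^ 2; gaussianReal 0 1] with hV₂
  refine ⟨V₁ + V₂, fun p q η hη => ?_⟩
  set w : Fin p ⊕ Fin q → ℝ → ℝ := Sum.elim (fun _ t => t ^ 2) (fun _ t => max t 0 ^ 2) with hw
  have hL : ∀ r, MemLp (w r) 2 (gaussianReal 0 1) := by
    rintro (r | r)
    · exact memLp_sq_gaussianReal
    · exact memLp_posPart_sq_gaussianReal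
  have hL' : ∀ r, MemLp (fun h : Fin p ⊕ Fin q → ℝ => w r (h r)) 2 (stdPi (Fin p ⊕ Fin q)) :=
    fun r => (hL r).comp_measurePreserving (measurePreserving_eval_stdPi r)
  have hsum : (coneSq : (Fin p ⊕ Fin q → ℝ) → ℝ) = ∑ r, fun h => w r (h r) := by
    ext h
    simp [coneSq, hw, Fintype.sum_sum_type]
  have hLc : MemLp (coneSq : (Fin p ⊕ Fin q → ℝ) → ℝ) 2 (stdPi (Fin p ⊕ Fin q)) := by
    rw [hsum]; exact memLp_finsetSum' _ fun r _ => hL' r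
  have hvar : Var[coneSq; stdPi (Fin p ⊕ Fin q)] ≤ (V₁ + V₂) * ((p : ℝ) + q) := by
    rw [hsum, variance_sum_pi hL, Fintype.sum_sum_type]
    simp only [hw, Sum.elim_inl, Sum.elim_inr, ← hV₁, ← hV₂, Finset.sum_const, Finset.card_univ,
      Fintype.card_fin, nsmul_eq_mul]
    have h1 : 0 ≤ V₁ := variance_nonneg _ _
    have h2 : 0 ≤ V₂ := variance_nonneg _ _
    nlinarith [mul_nonneg h1 (Nat.cast_nonneg (α := ℝ) q),
      mul_nonneg h2 (Nat.cast_nonneg (α := ℝ) p)]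
  have hmean : ∫ h, coneSq h ∂(stdPi (Fin p ⊕ Fin q)) = (p : ℝ) + (q : ℝ) / 2 := by
    have e : ∀ r, ∫ h : Fin p ⊕ Fin q → ℝ, w r (h r) ∂(stdPi (Fin p ⊕ Fin q)) =
        ∫ t, w r t ∂(gaussianReal 0 1) := fun r => by
      rw [← (measurePreserving_eval_stdPi r).map_eq,
        integral_map (measurable_pi_apply r).aemeasurable]
      rw [(measurePreserving_eval_stdPi r).map_eq]
      exact (hL r).aestronglyMeasurable
    rw [hsum]
    simp only [Finset.sum_apply]
    rw [integral_finsetSum _ fun r _ => (hL' r).integrable (by norm_num)]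
    simp_rw [e]
    simp only [hw, Fintype.sum_sum_type, Sum.elim_inl, Sum.elim_inr, integral_sq_gaussianReal,
      integral_posPart_sq_gaussianReal, Finset.sum_const, Finset.card_univ, Fintype.card_fin,
      nsmul_eq_mul]
    ring
  refine (measure_mono ?_).trans ((meas_ge_le_variance_div_sq hLc hη).trans
    (ENNReal.ofReal_le_ofReal (div_le_div_of_nonneg_right hvar (sq_nonneg η))))
  intro h hh
  simp only [Set.mem_ofPred_eq] at hh ⊢
  rw [hmean, abs_sub_comm]
  exact le_trans (by linarith) (le_abs_self _)

theorem gaussianReal_Ici_le {s : ℝ} (hs : 0 < s) :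
    gaussianReal 0 1 {t | s ≤ t} ≤ ENNReal.ofReal (1 / s ^ 2) := by
  have := meas_ge_le_variance_div_sq (memLp_id_gaussianReal (μ := 0) (v := 1) 2) hs
  simp only [variance_id_gaussianReal, id, integral_id_gaussianReal, sub_zero] at this
  refine (measure_mono fun t ht => ?_).trans this
  exact le_trans ht (le_abs_self t)

/-- The error terms of the escape inequality at scale `√n` vanish in the limit. -/
theorem tendsto_escape_error {α₁ α₂ : ℝ} {m₁ m₂ : ℕ → ℕ}
    (hm₁ : Tendsto (fun n : ℕ => (m₁ n : ℝ) / (n : ℝ)) atTop (𝓝 α₁))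
    (hm₂ : Tendsto (fun n : ℕ => (m₂ n : ℝ) / (n : ℝ)) atTop (𝓝 α₂))
    {ε₁ δ : ℝ} (hε₁ : 0 < ε₁) (hδ : 0 < δ) :
    Tendsto (fun n : ℕ => stdPi (Fin (m₁ n) ⊕ Fin (m₂ n))
        {h | √(coneSq h) ≤
          ((1 - ε₁) * √((m₁ n : ℝ) + (m₂ n : ℝ) / 2) - 5 * δ * √(n : ℝ)) + 3 * (δ * √(n : ℝ))} +
      gaussianReal 0 1 {s | δ * √(n : ℝ) ≤ s}) atTop (𝓝 0) := by
  obtain ⟨V, hV⟩ := exists_measure_coneSq_le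
  have hn0 : Tendsto (fun n : ℕ => ((n : ℝ))⁻¹) atTop (𝓝 0) :=
    tendsto_inv_atTop_zero.comp tendsto_natCast_atTop_atTop
  have l1 : Tendsto (fun n : ℕ => ENNReal.ofReal
      (V * ((m₁ n : ℝ) + m₂ n) / (4 * δ ^ 2 * n) ^ 2)) atTop (𝓝 0) := by
    rw [← ENNReal.ofReal_zero]
    refine ENNReal.tendsto_ofReal ?_
    have := (((hm₁.add hm₂).mul hn0).const_mul (V / (4 * δ ^ 2) ^ 2))
    rw [mul_zero, mul_zero] at this
    refine this.congr' ?_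
    filter_upwards [eventually_gt_atTop 0] with n hn
    have : (n : ℝ) ≠ 0 := by exact_mod_cast hn.ne'
    field_simp
  have l2 : Tendsto (fun n : ℕ => ENNReal.ofReal (1 / (δ * √(n : ℝ)) ^ 2)) atTop (𝓝 0) := by
    rw [← ENNReal.ofReal_zero]
    refine ENNReal.tendsto_ofReal ?_
    have := hn0.const_mul (1 / δ ^ 2)
    rw [mul_zero] at this
    refine this.congr fun n => ?_
    rw [mul_pow, Real.sq_sqrt (Nat.cast_nonneg n)]
    field_simp
  have l := l1.add l2
  rw [add_zero] at l
  refine tendsto_of_tendsto_of_tendsto_of_le_of_le' tendsto_const_nhds l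
    (Eventually.of_forall fun _ => zero_le) ?_
  filter_upwards [eventually_gt_atTop 0] with n hn
  have hnpos : (0 : ℝ) < n := by exact_mod_cast hn
  have hd : 0 < δ * √(n : ℝ) := mul_pos hδ (Real.sqrt_pos.2 hnpos)
  -- With `d = δ√n` and `M = m₁ + m₂/2`, the event gives `√coneSq ≤ √M - 2d`. Hence `√M ≥ 2d`, and
  -- squaring gives `coneSq ≤ M - 4d²`, so `η = 4δ²n`.
  refine add_le_add ((measure_mono ?_).trans (hV (m₁ n) (m₂ n) (4 * δ ^ 2 * n) (by positivity)))
    (gaussianReal_Ici_le hd)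
  intro h hh
  simp only [Set.mem_ofPred_eq] at hh ⊢
  set M : ℝ := (m₁ n : ℝ) + (m₂ n : ℝ) / 2 with hM
  have hM0 : 0 ≤ M := by positivity
  set d := δ * √(n : ℝ) with hd'
  have hdd : d ^ 2 = δ ^ 2 * n := by rw [hd', mul_pow, Real.sq_sqrt hnpos.le]
  have hs0 := Real.sqrt_nonneg (coneSq h)
  have hss := Real.sq_sqrt (coneSq_nonneg h)
  have hMs0 := Real.sqrt_nonneg M
  have hMs := Real.sq_sqrt hM0
  have h1 : √(coneSq h) ≤ √M - 2 * d := by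
    have : (1 - ε₁) * √M ≤ √M := by nlinarith
    linarith
  have h2 : √(coneSq h) ^ 2 ≤ (√M - 2 * d) ^ 2 := pow_le_pow_left₀ hs0 h1 2
  have h3 : 2 * d ≤ √M := by linarith
  nlinarith [mul_le_mul_of_nonneg_left h3 hd.le]

/-! ### From the random cone to the two programs -/

/-- An i.i.d. standard normal family, reindexed injectively, has the standard Gaussian law. -/
theorem IsIIDStdNormal.hasLaw_comp {Ω ι κ : Type*} [MeasurableSpace Ω] [Fintype κ]
    {X : ι → Ω → ℝ} {P : Measure Ω} [IsProbabilityMeasure P] (hX : IsIIDStdNormal X P)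
    {e : κ → ι} (he : e.Injective) :
    HasLaw (fun ω k => X (e k) ω) (stdPi κ) P := by
  refine ⟨aemeasurable_pi_lambda _ fun k => (hX.1 (e k)).aemeasurable, ?_⟩
  rw [(iIndepFun_iff_map_fun_eq_pi_map fun k => (hX.1 (e k)).aemeasurable).1 (hX.2.precomp he)]
  congr 1
  ext1 k
  exact (hX.1 (e k)).map_eq

/-- The Gaussian vectors for which the auxiliary program meets `S` strictly. -/
def hitSet {n : ℕ} (S : Set (EuclideanSpace ℝ (Fin n))) (c : ℝ) : Set (Fin n → ℝ) :=
  {g | ∃ x ∈ S, g ⬝ᵥ x.ofLp + ‖x‖ * c < 0}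

theorem isOpen_hitSet {n : ℕ} (S : Set (EuclideanSpace ℝ (Fin n))) (c : ℝ) :
    IsOpen (hitSet S c) := by
  have : hitSet S c = ⋃ x ∈ S, {g | g ⬝ᵥ x.ofLp + ‖x‖ * c < 0} := by
    ext g; simp [hitSet]
  rw [this]
  refine isOpen_biUnion fun x _ => isOpen_lt ?_ continuous_const
  unfold dotProduct
  fun_prop

/-- Both conditions on `x` are invariant under positive scaling, so `S` can be projected to the unit
sphere; this is why `0` must be excluded. -/
theorem measure_feasible_le {Ω : Type*} [MeasurableSpace Ω] {P : Measure Ω}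
    [IsProbabilityMeasure P] {m₁ m₂ n : ℕ} {A : Ω → Matrix (Fin m₁) (Fin n) ℝ}
    {B : Ω → Matrix (Fin m₂) (Fin n) ℝ} (hAB : IsIIDStdNormal (entries A B) P)
    {S : Set (EuclideanSpace ℝ (Fin n))} (hS : (0 : EuclideanSpace ℝ (Fin n)) ∉ S)
    {δ : ℝ} (hδ : 0 < δ) (c : ℝ) :
    P {ω | ∃ x ∈ S, x ∈ feasibleSet (A ω) (B ω)} ≤ stdPi (Fin n) (hitSet S c) +
      (stdPi (Fin m₁ ⊕ Fin m₂) {h | √(coneSq h) ≤ c + 3 * δ} + gaussianReal 0 1 {s | δ ≤ s}) := by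
  have hlaw := hAB.hasLaw_comp
    (Equiv.sumProdDistrib (Fin m₁) (Fin m₂) (Fin n)).injective
  set K : Set (Fin n → ℝ) := (fun x : EuclideanSpace ℝ (Fin n) => (‖x‖⁻¹ • x).ofLp) '' S with hKdef
  have hne : ∀ x ∈ S, 0 < ‖x‖ := fun x hx => norm_pos_iff.2 fun h => hS (h ▸ hx)
  have hK : ∀ x ∈ K, ∑ j, x j ^ 2 = 1 := by
    rintro _ ⟨x, hx, rfl⟩
    have h1 := EuclideanSpace.norm_sq_eq (‖x‖⁻¹ • x)
    rw [norm_smul, norm_inv, norm_norm, inv_mul_cancel₀ (hne x hx).ne'] at h1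
    simpa only [Real.norm_eq_abs, sq_abs, one_pow] using h1.symm
  have key := measure_escape_le (R₁ := Fin m₁) (R₂ := Fin m₂) K hK hδ c
  rw [← hlaw.map_eq, add_assoc] at key
  -- `S` is arbitrary, so the event may be non-measurable; for outer measure this inequality is
  -- enough.
  refine (measure_mono ?_).trans ((Measure.le_map_apply hlaw.aemeasurable _).trans
    (key.trans (add_le_add (measure_mono ?_) le_rfl)))
  · rintro ω ⟨x, hx, hA, hB⟩
    refine ⟨_, ⟨x, hx, rfl⟩, fun r => ?_, fun r => ?_⟩
    · have h1 := congrFun hA r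
      simp only [Matrix.mulVec, dotProduct, Pi.zero_apply] at h1
      simp only [Equiv.sumProdDistrib_apply_left, entries, Sum.elim_inl, PiLp.smul_apply,
        smul_eq_mul, mul_left_comm _ ‖x‖⁻¹, ← Finset.mul_sum, h1,
        mul_zero]
    · have h1 := hB r
      simp only [Matrix.mulVec, dotProduct, Pi.zero_apply] at h1
      simp only [Equiv.sumProdDistrib_apply_right, entries, Sum.elim_inr, PiLp.smul_apply,
        smul_eq_mul, mul_left_comm _ ‖x‖⁻¹, ← Finset.mul_sum]
      exact mul_nonpos_of_nonneg_of_nonpos (inv_nonneg.2 (norm_nonneg x)) h1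
  · rintro g ⟨_, ⟨x, hx, rfl⟩, h⟩
    refine ⟨x, hx, ?_⟩
    have h1 : ∑ j, (‖x‖⁻¹ • x).ofLp j * g j = ‖x‖⁻¹ * (g ⬝ᵥ x.ofLp) := by
      rw [dotProduct, Finset.mul_sum]
      refine Finset.sum_congr rfl fun j _ => ?_
      simp only [PiLp.smul_apply, smul_eq_mul]
      ring
    simp only [h1] at h
    rw [inv_mul_eq_div, div_lt_iff₀ (hne x hx)] at h
    linarith

section Programs

variable {Ω Ω' : Type*} [MeasurableSpace Ω] [MeasurableSpace Ω'] {P : Measure Ω}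
  [IsProbabilityMeasure P] {Q : Measure Ω'} [IsProbabilityMeasure Q] {m₁ m₂ n : ℕ}
  {A : Ω → Matrix (Fin m₁) (Fin n) ℝ} {B : Ω → Matrix (Fin m₂) (Fin n) ℝ} {g : Fin n → Ω' → ℝ}

theorem measure_xi_lt_le (hAB : IsIIDStdNormal (entries A B) P) (hg : IsIIDStdNormal g Q)
    (f : EuclideanSpace ℝ (Fin n) → ℝ) (t ε₁ ε₅ : ℝ) {δ : ℝ} (hδ : 0 < δ) :
    P {ω | (t : EReal) ≤ xi f (A ω) (B ω)}ᶜ ≤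
      Q {ω | 0 ≤ auxL f t m₁ m₂ ε₁ ε₅ fun i => g i ω}ᶜ +
      (stdPi (Fin m₁ ⊕ Fin m₂) {h | √(coneSq h) ≤
          ((1 - ε₁) * √((m₁ : ℝ) + (m₂ : ℝ) / 2) - ε₅ * √(n : ℝ)) + 3 * δ} +
        gaussianReal 0 1 {s | δ ≤ s}) := by
  have haux : ∀ ω, (∃ x, f x < t ∧ x ∈ auxFeasibleSet m₁ m₂ ε₁ ε₅ fun i => g i ω) →
      ω ∈ {ω | 0 ≤ auxL f t m₁ m₂ ε₁ ε₅ fun i => g i ω}ᶜ := by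
    rintro ω ⟨x, hx, hxa⟩ h
    have h1 : (0 : EReal) ≤ ((f x - t : ℝ) : EReal) := le_trans h (iInf₂_le x hxa)
    have h2 : (0 : ℝ) ≤ f x - t := by exact_mod_cast h1
    linarith
  -- The origin is always feasible for the auxiliary program, so here `auxL < 0` surely and the
  -- bound is trivial.
  by_cases h0 : f 0 < t
  · have : {ω | 0 ≤ auxL f t m₁ m₂ ε₁ ε₅ fun i => g i ω}ᶜ = Set.univ :=
      Set.eq_univ_of_forall fun ω => haux ω ⟨0, h0, by simp [auxFeasibleSet]⟩
    rw [this, measure_univ]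
    exact prob_le_one.trans le_self_add
  refine le_trans (measure_mono ?_) ((measure_feasible_le hAB (S := {x | f x < t}) h0 hδ _).trans
    (add_le_add ?_ le_rfl))
  · intro ω hω
    simp only [Set.mem_compl_iff, Set.mem_ofPred_eq, not_le, xi, iInf_lt_iff] at hω
    obtain ⟨x, hx, hlt⟩ := hω
    exact ⟨x, by exact_mod_cast hlt, hx⟩
  · have hlaw := hg.hasLaw_comp (e := id) Function.injective_id
    rw [← hlaw.map_eq, Measure.map_apply_of_aemeasurable hlaw.aemeasurable
      (isOpen_hitSet _ _).measurableSet]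
    refine measure_mono ?_
    rintro ω ⟨x, hx, h⟩
    exact haux ω ⟨x, hx, h.le⟩

/-- The infimum need not be attained, so `xi ≤ t` only yields feasible points with `f x < t + η` for
each `η > 0`. The escape bound is applied to the sets `{f < t + u k}` with `u k ↓ 0`, and continuity
from above is used on the `g` side. -/
theorem measure_xi_le_le (hAB : IsIIDStdNormal (entries A B) P) (hg : IsIIDStdNormal g Q)
    (f : EuclideanSpace ℝ (Fin n) → ℝ) (t ε₁ ε₅ : ℝ) {δ : ℝ} (hδ : 0 < δ) :
    P {ω | (t : EReal) < xi f (A ω) (B ω)}ᶜ ≤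
      Q {ω | 0 < auxL f t m₁ m₂ ε₁ ε₅ fun i => g i ω}ᶜ +
      (stdPi (Fin m₁ ⊕ Fin m₂) {h | √(coneSq h) ≤
          ((1 - ε₁) * √((m₁ : ℝ) + (m₂ : ℝ) / 2) - ε₅ * √(n : ℝ)) + 3 * δ} +
        gaussianReal 0 1 {s | δ ≤ s}) := by
  set c := (1 - ε₁) * √((m₁ : ℝ) + (m₂ : ℝ) / 2) - ε₅ * √(n : ℝ) with hc
  have haux : ∀ ω, (∀ η : ℝ, 0 < η →
        ∃ x, f x < t + η ∧ x ∈ auxFeasibleSet m₁ m₂ ε₁ ε₅ fun i => g i ω) →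
      ω ∈ {ω | 0 < auxL f t m₁ m₂ ε₁ ε₅ fun i => g i ω}ᶜ := by
    intro ω h hpos
    obtain ⟨r, hr0, hr⟩ := EReal.lt_iff_exists_real_btwn.1 hpos
    obtain ⟨x, hx, hxa⟩ := h r (by exact_mod_cast hr0)
    have h1 : (r : EReal) < ((f x - t : ℝ) : EReal) := lt_of_lt_of_le hr (iInf₂_le x hxa)
    have h2 : r < f x - t := by exact_mod_cast h1
    linarith
  by_cases h0 : f 0 ≤ t
  · have : {ω | 0 < auxL f t m₁ m₂ ε₁ ε₅ fun i => g i ω}ᶜ = Set.univ :=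
      Set.eq_univ_of_forall fun ω => haux ω fun η hη =>
        ⟨0, by linarith, by simp [auxFeasibleSet]⟩
    rw [this, measure_univ]
    exact prob_le_one.trans le_self_add
  push Not at h0
  obtain ⟨u, hu_anti, hu_pos, hu_lim⟩ := exists_seq_strictAnti_tendsto (0 : ℝ)
  set S : ℕ → Set (EuclideanSpace ℝ (Fin n)) := fun k => {x | f x < t + u k} with hS
  have hanti : Antitone fun k => hitSet (S k) c := by
    rintro k l hkl g ⟨x, hx, h⟩
    exact ⟨x, lt_of_lt_of_le hx (add_le_add le_rfl (hu_anti.antitone hkl)), h⟩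
  have hlim := tendsto_measure_iInter_atTop (μ := stdPi (Fin n))
    (fun k => (isOpen_hitSet (S k) c).measurableSet.nullMeasurableSet) hanti
    ⟨0, measure_ne_top _ _⟩
  have hlaw := hg.hasLaw_comp (e := id) Function.injective_id
  have hle : stdPi (Fin n) (⋂ k, hitSet (S k) c) ≤
      Q {ω | 0 < auxL f t m₁ m₂ ε₁ ε₅ fun i => g i ω}ᶜ := by
    rw [← hlaw.map_eq, Measure.map_apply_of_aemeasurable hlaw.aemeasurable
      (MeasurableSet.iInter fun k => (isOpen_hitSet _ _).measurableSet)]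
    refine measure_mono fun ω hω => haux ω fun η hη => ?_
    obtain ⟨k, hk⟩ := (hu_lim.eventually (gt_mem_nhds hη)).exists
    obtain ⟨x, hx, h⟩ := Set.mem_iInter.1 hω k
    exact ⟨x, lt_trans hx (by linarith), h.le⟩
  refine le_trans ?_ (add_le_add hle le_rfl)
  refine ge_of_tendsto (hlim.add_const _) ?_
  -- Once `u k < f 0 - t`, the origin lies outside `S k`.
  filter_upwards [hu_lim.eventually (gt_mem_nhds (sub_pos.2 h0))] with k hk
  refine le_trans (measure_mono ?_) (measure_feasible_le hAB (S := S k)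
    (fun h => by simp only [hS, Set.mem_ofPred_eq] at h; linarith) hδ _)
  intro ω hω
  simp only [Set.mem_compl_iff, Set.mem_ofPred_eq, not_lt] at hω
  have : xi f (A ω) (B ω) < ((t + u k : ℝ) : EReal) :=
    lt_of_le_of_lt hω (by exact_mod_cast lt_add_of_pos_right t (hu_pos k))
  simp only [xi, iInf_lt_iff] at this
  obtain ⟨x, hx, hlt⟩ := this
  exact ⟨x, by exact_mod_cast hlt, hx⟩

end Programs

/-- Probabilities that fail to be overwhelming only up to a vanishing error tend to one. -/
theorem WithOverwhelmingProb.tendsto_prob {Ω Ω' : ℕ → Type*} [∀ n, MeasurableSpace (Ω n)]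
    [∀ n, MeasurableSpace (Ω' n)] {P : ∀ n, Measure (Ω n)} {Q : ∀ n, Measure (Ω' n)}
    [∀ n, IsProbabilityMeasure (Q n)] {s : ∀ n, Set (Ω n)} {s' : ∀ n, Set (Ω' n)}
    (hs : WithOverwhelmingProb Q s') {e : ℕ → ENNReal} (he : Tendsto e atTop (𝓝 0))
    (h : ∀ᶠ n in atTop, P n (s n)ᶜ ≤ Q n (s' n)ᶜ + e n) :
    Tendsto (fun n => prob (P n) (s n)) atTop (𝓝 1) := by
  obtain ⟨c, hc, hev⟩ := hs
  have hexp : Tendsto (fun n : ℕ => ENNReal.ofReal (Real.exp (-c * (n : ℝ)))) atTop (𝓝 0) := by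
    rw [← ENNReal.ofReal_zero]
    refine ENNReal.tendsto_ofReal (Real.tendsto_exp_atBot.comp ?_)
    exact tendsto_natCast_atTop_atTop.const_mul_atTop_of_neg (neg_lt_zero.2 hc)
  have hl := hexp.add he
  rw [add_zero] at hl
  have hP : Tendsto (fun n => P n (s n)ᶜ) atTop (𝓝 0) := by
    refine tendsto_of_tendsto_of_tendsto_of_le_of_le' tendsto_const_nhds hl
      (Eventually.of_forall fun _ => zero_le) ?_
    filter_upwards [h, hev] with n h1 h2
    refine h1.trans (add_le_add ?_ le_rfl)
    unfold prob at h2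
    rw [ENNReal.le_ofReal_iff_toReal_le (measure_ne_top _ _) (Real.exp_pos _).le]
    rw [measureReal_def] at h2
    linarith
  have := (ENNReal.tendsto_toReal ENNReal.zero_ne_top).comp hP
  simpa [prob, measureReal_def] using this.const_sub 1

end RandLinCons

theorem mainTheorem1
    {Ω Ω' : ℕ → Type*} [∀ n, MeasurableSpace (Ω n)] [∀ n, MeasurableSpace (Ω' n)]
    (P : ∀ n, Measure (Ω n)) [∀ n, IsProbabilityMeasure (P n)]
    (Q : ∀ n, Measure (Ω' n)) [∀ n, IsProbabilityMeasure (Q n)]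
    (α₁ α₂ : ℝ) (m₁ m₂ : ℕ → ℕ)
    (hm₁ : Tendsto (fun n : ℕ => (m₁ n : ℝ) / (n : ℝ)) atTop (𝓝 α₁))
    (hm₂ : Tendsto (fun n : ℕ => (m₂ n : ℝ) / (n : ℝ)) atTop (𝓝 α₂))
    (A : ∀ n, Ω n → Matrix (Fin (m₁ n)) (Fin n) ℝ)
    (B : ∀ n, Ω n → Matrix (Fin (m₂ n)) (Fin n) ℝ)
    (hAB : ∀ n, RandLinCons.IsIIDStdNormal (RandLinCons.entries (A n) (B n)) (P n))
    (g : ∀ n, Fin n → Ω' n → ℝ)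
    (hg : ∀ n, RandLinCons.IsIIDStdNormal (g n) (Q n))
    (f : ∀ n, EuclideanSpace ℝ (Fin n) → ℝ)
    (hfin : RandLinCons.WithOverwhelmingProb P fun n =>
      {ω | RandLinCons.xi (f n) (A n ω) (B n ω) ≠ ⊥ ∧ RandLinCons.xi (f n) (A n ω) (B n ω) ≠ ⊤})
    (ε₁ ε₅ : ℝ) (hε₁ : 0 < ε₁) (hε₅ : 0 < ε₅)
    (ξD : ℕ → ℝ)
    (hξD : RandLinCons.WithOverwhelmingProb Q fun n =>
      {ω | 0 ≤ RandLinCons.auxL (f n) (ξD n) (m₁ n) (m₂ n) ε₁ ε₅ (fun i => g n i ω)}) :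
    Tendsto (fun n => RandLinCons.prob (P n)
        {ω | (ξD n : EReal) ≤ RandLinCons.xi (f n) (A n ω) (B n ω)}) atTop (𝓝 1) ∧
    ((RandLinCons.WithOverwhelmingProb Q fun n =>
        {ω | 0 < RandLinCons.auxL (f n) (ξD n) (m₁ n) (m₂ n) ε₁ ε₅ (fun i => g n i ω)}) →
      Tendsto (fun n => RandLinCons.prob (P n)
        {ω | (ξD n : EReal) < RandLinCons.xi (f n) (A n ω) (B n ω)}) atTop (𝓝 1)) := by
  -- Of the five parts of `ε₅`, three absorb the comparison loss `3δ` and two give the deviation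
  -- margin.
  have herr := RandLinCons.tendsto_escape_error hm₁ hm₂ hε₁ (δ := ε₅ / 5) (by positivity)
  have h5 : 5 * (ε₅ / 5) = ε₅ := by ring
  rw [h5] at herr
  have hδ : ∀ᶠ n : ℕ in atTop, 0 < ε₅ / 5 * √(n : ℝ) := by
    filter_upwards [eventually_gt_atTop 0] with n hn
    have : (0 : ℝ) < n := by exact_mod_cast hn
    positivity
  refine ⟨hξD.tendsto_prob herr ?_, fun hpos => hpos.tendsto_prob herr ?_⟩
  · filter_upwards [hδ] with n hn
    exact RandLinCons.measure_xi_lt_le (hAB n) (hg n) (f n) (ξD n) ε₁ ε₅ hn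
  · filter_upwards [hδ] with n hn
    exact RandLinCons.measure_xi_le_le (hAB n) (hg n) (f n) (ξD n) ε₁ ε₅ hn
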